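/- **Setting.** Let $\gamma=1/36$ and $\varphi=3\gamma k=\Theta(k)$. There are $n=k^d$ servers, the elements of $[k]^d$; server $x$ emulates the nodes $(0,x),\dots,(d,x)$ of the $k$-ary butterfly of dimension $d=\log_k n$, in which $(j,x)$ and $(j+1,y)$ are adjacent iff $x,y$ agree outside coordinate $j+1$. For a node $v=(\ell,x)$, $BF(v)$ is the sub-butterfly on levels $0,\dots,\ell$ whose rows agree with $x$ in the coordinates $\ell+1,\dots,d$. Data items are identified with keys in $U=\{0,1\}^\Lambda$, $m=|U|=2^\Lambda$; fix a zone $z\le\Lambda$. The first $z$ bits of a key determine its bucket. *History.* In every period an adversary, knowing the entire past, crashes fewer than $\frac{\gamma}{2}2^{d}$ servers and may have one bucket of zone $z$ encoded anew with some set of items; then hash functions $h_1,\dots,h_c:U\to[k]^d$ are drawn uniformly and independently for it. A server stores for a bucket the number (timestamp) of the last period in which the bucket was encoded while the server was intact. In the current period $T$ the adversary (knowing everything so far) finally places at most one lookup request at each server; requests at crashed servers are ignored. *Probing Stage.* An intact server $s$ with a request for $d$ asks $q$ uniformly random intact servers for their timestamps of $d$'s bucket, lets $t$ be the largest of these and its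 own, and uses the hash functions of time $t$ (if the bucket was, as far as $s$ can tell, never encoded, the request is finished). It draws $c$ independent uniformly random intact servers $s(d_1),\dots,s(d_c)$ and sends, for each $i$, a probe $(d,i,t)$ along the unique butterfly path of length $\log_k n$ from level $\log_k n$ at $s(d_i)$ to level $0$ at $h_i(d)$; $s_i^{(\ell)}(d)$ is the level $\ell$ node of this path. Equal probes meeting at a node are combined. A node that receives more than $\alpha c$ different probes stops all of them. A probe that passes all levels is answered if server $h_i(d)$ is intact and has timestamp $t$. The request is finished if at least $c/3$ probes are answered (or, if $d$ is not in the bucket, at least one). Otherwise it is declared to belong to the smallest level $\ell\in\{1,\dots,\log_k n\}$ at which at least $5c/6$ of its probes are active, i.e. have passed level $\ell$ and all larger levels. *Decoding Stage.* In sub-phase $\ell=1,\dots,\log_k n$, for each request belonging to level $\ell$, $\lceil 5c/6\rceil$ arbitrary indices $i$ active at level $\ell$ are selected, and a decode message $(d,i,t)$ is sent to $v=s_i^{(\ell)}(d)$. Every node on levels $\ell,\ell-1,\dots,1$ that has received at most $\beta ck$ different messages forwards all of them to its $k$ neighbours on the next smaller level; a node that has received more is congested and forwards none. Piece $i$ is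 recovered if $v$ is not congested, no node of $BF(v)$ on levels $1,\dots,\ell-1$ is congested, and the distributed decoding succeeds at $(0,h_i(d))$: a node of level $\ell$ is available iff its server is intact and has timestamp $t$; a node of a smaller level is available iff its server is so, or at most one of its $k$ neighbours on the next larger level is not available. The request is finished if at least $c/3$ selected pieces are recovered (or, if $d$ is not in the bucket, if for some selected piece $BF(v)$ is free of congestion in the above sense and contains an intact server with timestamp $t$). Otherwise it belongs to level $\ell+1$ from then on. **Lemma.** There are constants $\alpha_0,\beta_0>0$ such that for all $a,p,\tau\in\mathbb N$ and $q_0>0$ there are $C_0>0$ and $n_0$ such that the following holds whenever $\alpha\ge\alpha_0$, $\beta\ge\beta_0$, $n=k^d\ge n_0$, $k\ge 36$, $n\le m\le n^p$, $c\ge C_0\log m$, $q\ge q_0\log n$ and $1\le T\le n^\tau$. For every adversary, with probability at least $1-n^{-a}$, for all selections of pieces in the Decoding Stage and at the beginning of every sub-phase $\ell\in\{1,\dots,\log_k n\}$, the number of data items with requests belonging to level $\ell$ is at most $\varphi n/k^\ell$. -/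

import Mathlib

noncomputable section

namespace RoBuSt

/-- The constant `γ`. -/
def gamma : ℝ := 1 / 36

/-- Parameters of the system, and the zone `z` that is currently examined:
arity `k` and dimension `d` of the butterfly, number `c` of pieces of a data item, number `q` of
servers that are asked for their timestamp, length `Λ` of the keys. -/
structure Params where
  k : ℕ
  d : ℕ
  c : ℕ
  q : ℕ
  Λ : ℕ
  z : ℕ
  two_le_k : 2 ≤ k
  z_le : z ≤ Λ

variable {P : Params}

/-- The number of servers. -/
def Params.n (P : Params) : ℕ := P.k ^ P.d

/-- The size of the universe of keys. -/
def Params.m (P : Params) : ℕ := 2 ^ P.Λ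

/-- `φ = 3γk`. -/
def Params.phi (P : Params) : ℝ := 3 * gamma * P.k

/-- A server is a row of the `k`-ary butterfly of dimension `d`; server `x` emulates the
butterfly nodes `(0, x), …, (d, x)`. -/
abbrev Server (P : Params) := Fin P.d → Fin P.k

/-- Data items are identified with their keys. -/
abbrev Key (P : Params) := Fin P.Λ → Bool

/-- The `2 ^ z` buckets of zone `z`. -/
abbrev Bucket (P : Params) := Fin P.z → Bool

/-- The only bucket of zone `z` that may hold the data item `a`. -/
def bucketOf (a : Key P) : Bucket P := fun i => a (Fin.castLE P.z_le i)

instance : Nonempty (Server P) := ⟨fun _ => ⟨0, by have := P.two_le_k; omega⟩⟩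

/-! ### The butterfly -/

/-- There is a butterfly edge between `(j, x)` and `(j + 1, y)`. The coordinates are numbered from
`0`, so the one that changes between levels `j` and `j + 1` is coordinate `j`. -/
def Adj (j : ℕ) (x y : Server P) : Prop := ∀ i : Fin P.d, (i : ℕ) ≠ j → y i = x i

open scoped Classical in
/-- The servers of the sub-butterfly `BF((ℓ, x))` of dimension `ℓ`, which ranges over the
levels `0, …, ℓ`. -/
def subBF (ℓ : ℕ) (x : Server P) : Finset (Server P) :=
  Finset.univ.filter fun y => ∀ i : Fin P.d, ℓ ≤ (i : ℕ) → y i = x i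

/-- The row of the level `ℓ` node of the unique path of length `d` from `(d, s)` to `(0, h)`. -/
def pathNode (s h : Server P) (ℓ : ℕ) : Server P := fun i => if (i : ℕ) < ℓ then s i else h i

/-! ### The past of the system, and the adversary -/

/-- What is settled in a period before hash functions are drawn: the crashed servers, and (if
there is one) the bucket of zone `z` that is encoded anew, with the data items it then stores. -/
structure Move (P : Params) where
  crashed : Finset (Server P)
  crashed_lt : (crashed.card : ℝ) < gamma / 2 * 2 ^ P.d
  encoded : Option (Bucket P × Finset (Key P))

/-- A period: the adversary's move, and the `c` hash functions drawn afterwards for the bucket that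
is encoded in this period (they are not used if there is none). -/
structure Period (P : Params) where
  move : Move P
  hash : Key P → Fin P.c → Server P

/-- The periods up to the current one, the latest first. -/
abbrev History (P : Params) := List (Period P)

/-- The servers that are crashed in the current period. -/
def crashedNow : History P → Finset (Server P)
  | [] => ∅
  | p :: _ => p.move.crashed

open scoped Classical in
/-- The timestamp that server `x` stores for bucket `b`: the number of the last period in which `b`
was encoded while `x` was intact (`0` if there is none; periods are numbered from `1`). -/
def stamp : History P → Server P → Bucket P → ℕ
  | [], _, _ => 0
  | p :: past, x, b =>
    if (∃ D, p.move.encoded = some (b, D)) ∧ x ∉ p.move.crashed then past.length + 1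
    else stamp past x b

/-- The hash functions of period `t`. -/
def hashAt : History P → ℕ → Key P → Fin P.c → Server P
  | [], _ => fun _ _ => Classical.arbitrary _
  | p :: past, t => if t = past.length + 1 then p.hash else hashAt past t

/-- The data items that were encoded in period `t`. -/
def itemsAt : History P → ℕ → Finset (Key P)
  | [], _ => ∅
  | p :: past, t =>
    if t = past.length + 1 then (p.move.encoded.elim ∅ fun e => e.2) else itemsAt past t

/-- The unserved lookup requests at the beginning of the examination of zone `z`: the servers that
hold one (only intact ones count), and the data item requested at each of them. -/
structure Batch (P : Params) where
  holders : Finset (Server P)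
  item : Server P → Key P

/-- An adaptive adversary. Its choices may be random and may depend on the entire past, including
all hash functions that have been drawn, but not on future random choices of the system. -/
structure Adversary (P : Params) where
  move : History P → PMF (Move P)
  batch : History P → PMF (Batch P)

/-- The random history of the first `T` periods: in each period the adversary moves, and then fresh
hash functions are chosen uniformly and independently at random. -/
def randomHistory (A : Adversary P) : ℕ → PMF (History P)
  | 0 => PMF.pure []
  | T + 1 => (randomHistory A T).bind fun H => (A.move H).bind fun mv =>
      (PMF.uniformOfFintype (Key P → Fin P.c → Server P)).map fun h => ⟨mv, h⟩ :: H

abbrev Intact (H : History P) := {x : Server P // x ∉ crashedNow H}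

theorem crashedNow_card_lt (H : History P) :
    ((crashedNow H).card : ℝ) < gamma / 2 * 2 ^ P.d := by
  cases H with
  | nil => simp [crashedNow, gamma]
  | cons p _ => exact p.move.crashed_lt

instance (H : History P) : Nonempty (Intact H) := by
  by_contra hne
  have hall : crashedNow H = Finset.univ := by
    ext x
    simp only [Finset.mem_univ, iff_true]
    by_contra hx
    exact hne ⟨⟨x, hx⟩⟩
  have h1 := crashedNow_card_lt H
  rw [hall, Finset.card_univ] at h1
  simp only [Fintype.card_pi, Fintype.card_fin, Finset.prod_const, Finset.card_univ,
    Nat.cast_pow] at h1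
  have h2 : (2 : ℝ) ^ P.d ≤ (P.k : ℝ) ^ P.d :=
    pow_le_pow_left₀ (by norm_num) (by exact_mod_cast P.two_le_k) _
  have h3 : (0 : ℝ) < 2 ^ P.d := by positivity
  unfold gamma at h1
  linarith

/-- Everything the examination of zone `z` depends on: the history, the requests, for every
server `s` the `q` intact servers it asks for timestamps, and the `c` intact
servers `s(d_1), …, s(d_c)` from which its probes start. -/
structure Outcome (P : Params) where
  hist : History P
  batch : Batch P
  asked : Server P → Fin P.q → Server P
  start : Server P → Fin P.c → Server P

/-- The law of the outcome in period `T`. The asked servers and the starting points of the probes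
are chosen uniformly and independently at random among the intact servers. -/
def randomOutcome (A : Adversary P) (T : ℕ) : PMF (Outcome P) :=
  (randomHistory A T).bind fun H => (A.batch H).bind fun B =>
    (PMF.uniformOfFintype (Server P → Fin P.q → Intact H)).bind fun ask =>
      (PMF.uniformOfFintype (Server P → Fin P.c → Intact H)).map fun st =>
        { hist := H, batch := B,
          asked := fun s j => (ask s j).1, start := fun s i => (st s i).1 }

namespace Outcome

variable (o : Outcome P)

/-! ### Probing Stage -/

/-- The timestamp that server `s` uses for its request: the largest one among its own
and those it received. -/
def time (s : Server P) : ℕ :=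
  max (stamp o.hist s (bucketOf (o.batch.item s)))
    (Finset.univ.sup fun j => stamp o.hist (o.asked s j) (bucketOf (o.batch.item s)))

/-- `s` is an intact server with an unserved lookup request, for a data item whose bucket has
(as far as `s` could find out) been encoded before. -/
def Live (s : Server P) : Prop := s ∈ o.batch.holders ∧ s ∉ crashedNow o.hist ∧ 0 < o.time s

/-- The server responsible for `h_i(d)`, where `d` is the data item requested at `s`. -/
def dest (s : Server P) (i : Fin P.c) : Server P := hashAt o.hist (o.time s) (o.batch.item s) i

/-- The row of the node `s_i^(ℓ)(d)`. -/
def node (s : Server P) (i : Fin P.c) (ℓ : ℕ) : Server P := pathNode (o.start s i) (o.dest s i) ℓ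

/-- Messages concern a data item, the index of a piece, and a timestamp. Messages that agree in all
three are combined. -/
abbrev Msg (P : Params) := Key P × Fin P.c × ℕ

def msg (s : Server P) (i : Fin P.c) : Msg P := (o.batch.item s, i, o.time s)

open scoped Classical in
/-- The different messages at the nodes of level `ℓ`, when the pairs `(s, i)` that send a message
along their path as far as level `ℓ` are those satisfying `send`. -/
def msgsAt (send : Server P → Fin P.c → Prop) (ℓ : ℕ) (u : Server P) : Finset (Msg P) :=
  (Finset.univ.filter fun e : Server P × Fin P.c => send e.1 e.2 ∧ o.node e.1 e.2 ℓ = u).image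
    fun e => o.msg e.1 e.2

/-- The `i`-th probe of `s` reaches level `d - j`. A node that receives more than `αc` different
probes stops all of them. -/
def Arrives (α : ℝ) : ℕ → Server P → Fin P.c → Prop
  | 0, s, _ => o.Live s
  | j + 1, s, i => Arrives α j s i ∧
      ¬ α * P.c < ((o.msgsAt (Arrives α j) (P.d - j) (o.node s i (P.d - j))).card : ℝ)

open scoped Classical in
/-- The indices of the probes of `s` that are active at level `ℓ ≤ d`: those that passed level `ℓ`
and all levels `ℓ' > ℓ`. -/
def active (α : ℝ) (ℓ : ℕ) (s : Server P) : Finset (Fin P.c) :=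
  Finset.univ.filter fun i => o.Arrives α (P.d - ℓ + 1) s i

/-- Server `x` is intact, and its version of the bucket has the timestamp used by `s`. -/
def UpToDate (s x : Server P) : Prop :=
  x ∉ crashedNow o.hist ∧ stamp o.hist x (bucketOf (o.batch.item s)) = o.time s

/-- The item requested at `s` exists in the version of the bucket that `s` is looking for. -/
def Stored (s : Server P) : Prop := o.batch.item s ∈ itemsAt o.hist (o.time s)

open scoped Classical in
/-- The indices of the probes of `s` that are answered with a piece, or with the information
that the item does not exist in the bucket. -/
def answered (α : ℝ) (s : Server P) : Finset (Fin P.c) :=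
  (o.active α 0 s).filter fun i => o.UpToDate s (o.dest s i)

/-- The request at `s` is finished by the Probing Stage: `c / 3` pieces have been received, or the
item does not exist and at least one server has reported this. -/
def Probed (α : ℝ) (s : Server P) : Prop :=
  (o.Stored s ∧ P.c ≤ 3 * (o.answered α s).card) ∨ (¬ o.Stored s ∧ (o.answered α s).Nonempty)

/-- The Probing Stage declares the request at `s` to belong to level `ℓ`. -/
def Declared (α : ℝ) (ℓ : ℕ) (s : Server P) : Prop :=
  o.Live s ∧ ¬ o.Probed α s ∧
    IsLeast {j : ℕ | 1 ≤ j ∧ j ≤ P.d ∧ 5 * P.c ≤ 6 * (o.active α j s).card} ℓ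

/-! ### Decoding Stage -/

/-- `sel ℓ s` is a choice of `5c / 6` (rounded up) indices of pieces that were active at level `ℓ`
in the Probing Stage, for all requests with at least `5c / 6` such indices. -/
def Selection (α : ℝ) (sel : ℕ → Server P → Finset (Fin P.c)) : Prop :=
  ∀ ℓ s, 5 * P.c ≤ 6 * (o.active α ℓ s).card →
    sel ℓ s ⊆ o.active α ℓ s ∧ (sel ℓ s).card = (5 * P.c + 5) / 6

open scoped Classical in
/-- The different messages that the node `(ℓ - j, u)` receives in sub-phase `ℓ`, when `R` holds for
the requests belonging to level `ℓ`. For `j = 0` these are the decode messages; every node that has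
received at most `βck` of them, or at most `βck` of the check messages into which they are turned,
forwards all of them to its neighbours at the next smaller level. -/
def received (β : ℝ) (sel : ℕ → Server P → Finset (Fin P.c)) (R : Server P → Prop) (ℓ : ℕ) :
    ℕ → Server P → Finset (Msg P)
  | 0, u => o.msgsAt (fun s i => R s ∧ i ∈ sel ℓ s) ℓ u
  | j + 1, u =>
    (Finset.univ.filter fun v => Adj (ℓ - (j + 1)) u v ∧
      ((received β sel R ℓ j v).card : ℝ) ≤ β * P.c * P.k).biUnion (received β sel R ℓ j)

/-- The node `(ℓ, v)` finds out that `BF((ℓ, v))` can be decoded without congestion: `(ℓ, v)` itself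
is not congested, and neither is any node of `BF((ℓ, v))` at a level `ℓ - j` with `1 ≤ j < ℓ`. -/
def CongestionFree (β : ℝ) (sel : ℕ → Server P → Finset (Fin P.c)) (R : Server P → Prop) (ℓ : ℕ)
    (v : Server P) : Prop :=
  ((o.received β sel R ℓ 0 v).card : ℝ) ≤ β * P.c * P.k ∧
    ∀ j, 1 ≤ j → j < ℓ → ∀ u ∈ subBF ℓ v,
      ((o.received β sel R ℓ j u).card : ℝ) ≤ β * P.c * P.k

open scoped Classical in
/-- The distributed decoding from level `ℓ` up to level `0`, with the servers satisfying `good`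
knowing their own data: the information of the node `(ℓ - j, x)` is available. It is, if `x` knows
it, or if it is available at all but at most one of the `k` neighbours at the next larger level. -/
def Available (good : Server P → Prop) (ℓ : ℕ) : ℕ → Server P → Prop
  | 0, x => good x
  | j + 1, x => good x ∨
      (Finset.univ.filter fun y => Adj (ℓ - (j + 1)) x y ∧ ¬ Available good ℓ j y).card ≤ 1

open scoped Classical in
/-- The request at `s` is finished by sub-phase `ℓ`: at least `c / 3` of the selected pieces are
recovered, or the item does not exist and an intact up-to-date server takes part in the decoding for
one of them. -/
def Recovered (β : ℝ) (sel : ℕ → Server P → Finset (Fin P.c)) (R : Server P → Prop) (ℓ : ℕ)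
    (s : Server P) : Prop :=
  (o.Stored s ∧ P.c ≤ 3 * ((sel ℓ s).filter fun i =>
      o.CongestionFree β sel R ℓ (o.node s i ℓ) ∧
        Available (o.UpToDate s) ℓ ℓ (o.dest s i)).card) ∨
  (¬ o.Stored s ∧ ∃ i ∈ sel ℓ s, o.CongestionFree β sel R ℓ (o.node s i ℓ) ∧
      ∃ x ∈ subBF ℓ (o.node s i ℓ), o.UpToDate s x)

/-- At the beginning of sub-phase `ℓ ≥ 1` of the Decoding Stage, the request at `s` belongs
to level `ℓ`. -/
def Belongs (α β : ℝ) (sel : ℕ → Server P → Finset (Fin P.c)) : ℕ → Server P → Prop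
  | 0, _ => False
  | ℓ + 1, s => o.Declared α (ℓ + 1) s ∨
      (Belongs α β sel ℓ s ∧ ¬ o.Recovered β sel (Belongs α β sel ℓ) ℓ s)

open scoped Classical in
/-- The data items with requests belonging to level `ℓ` at the beginning of sub-phase `ℓ`. -/
def itemsAtLevel (α β : ℝ) (sel : ℕ → Server P → Finset (Fin P.c)) (ℓ : ℕ) : Finset (Key P) :=
  (Finset.univ.filter (o.Belongs α β sel ℓ)).image o.batch.item

end Outcome

end RoBuSt

end

noncomputable section

namespace RoBuSt

open scoped ENNReal

/-! ### Discrete probability -/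

/-! Servers that agree in the coordinates `ℓ, ℓ + 1, …` form a class of level `ℓ`: the rows of one
sub-butterfly of dimension `ℓ`. There are `k ^ (d - ℓ)` classes, with `k ^ ℓ` servers each. The
level `ℓ` node of a path lies in the class of its destination, so stopped probes, congestion and
failed decoding can all be charged to classes of destinations `h_i(d)`.

Four events make the rest deterministic. `GoodPeriod`: hash functions send at most `c / 6` pieces of
any item to classes that are critical for the servers crashed when they were drawn. `Expands`: for
every set of at most `e⁻¹² k ^ (d - ℓ)` classes, at most `γ k ^ (d - ℓ)` pairs of a timestamp and an
item have more than `c / 6` pieces there. `Synced`: every request uses the latest version of its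
bucket. `Spread`: every node of a class that is not overloaded gets `O(c)` probes.

Under these events an item that belongs to level `ℓ + 1` must have more than `c / 6` pieces in one
of three sets of classes of level `ℓ` (`itemsAtLevel_succ_subset`): those where probes may be
stopped (`jammed`), those where the current crashes may prevent decoding (`crit`), and those with
too many pieces of the items of level `ℓ` (`congested`). Otherwise, of `5c / 6` pieces at most `c /
6` are lost to each of current crashes, outdated servers and congestion, and `c / 3` survive. Each
of the three sets has at most `e⁻¹² k ^ (d - ℓ)` classes, the last one by induction on `ℓ`, so
`Expands` leaves at most `3γ k ^ (d - ℓ) = φ n / k ^ (ℓ + 1)` items.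

The adversary sees the hash functions before it chooses the current crashes and requests. `Expands`
is therefore uniform over all sets of classes, by a union bound over exponential moments
(`not_expands_le`). The sets of outdated servers vary with the bucket, but each was fixed before the
hash functions in use were drawn, so `GoodPeriod` suffices for them. -/

theorem toOuterMeasure_bind_le_add {X Y : Type*} (p : PMF X) (f : X → PMF Y) (s : Set Y)
    (t : Set X) (ε : ℝ≥0∞)
    (h : ∀ a ∈ p.support, a ∉ t → (f a).toOuterMeasure s ≤ ε) :
    (p.bind f).toOuterMeasure s ≤ p.toOuterMeasure t + ε := by
  rw [PMF.toOuterMeasure_bind_apply, PMF.toOuterMeasure_apply]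
  calc ∑' a, p a * (f a).toOuterMeasure s
      ≤ ∑' a, (t.indicator p a + p a * ε) := by
        refine ENNReal.tsum_le_tsum fun a => ?_
        by_cases ha : a ∈ t
        · rw [Set.indicator_of_mem ha]
          refine le_add_right ?_
          calc p a * (f a).toOuterMeasure s ≤ p a * 1 := by
                gcongr
                rw [PMF.toOuterMeasure_apply]
                calc _ ≤ ∑' b, f a b :=
                      ENNReal.tsum_le_tsum fun b => Set.indicator_le_self' (by simp) b
                  _ = 1 := (f a).tsum_coe
            _ = p a := mul_one _
        · rw [Set.indicator_of_notMem ha, zero_add]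
          by_cases h0 : p a = 0
          · simp [h0]
          · gcongr
            exact h a ((p.mem_support_iff a).2 h0) ha
    _ = ∑' a, t.indicator p a + ε := by
        rw [ENNReal.tsum_add, ENNReal.tsum_mul_right, p.tsum_coe, one_mul]

theorem toOuterMeasure_bind_le {X Y : Type*} (p : PMF X) (f : X → PMF Y) (s : Set Y)
    (ε : ℝ≥0∞) (h : ∀ a ∈ p.support, (f a).toOuterMeasure s ≤ ε) :
    (p.bind f).toOuterMeasure s ≤ ε := by
  simpa using toOuterMeasure_bind_le_add p f s ∅ ε fun a ha _ => h a ha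

/-- The expectation of a nonnegative random variable. -/
def expect {X : Type*} (p : PMF X) (F : X → ℝ≥0∞) : ℝ≥0∞ := ∑' a, p a * F a

theorem expect_bind {X Y : Type*} (p : PMF X) (f : X → PMF Y) (F : Y → ℝ≥0∞) :
    expect (p.bind f) F = expect p fun a => expect (f a) F := by
  unfold expect
  simp only [PMF.bind_apply, ← ENNReal.tsum_mul_right, ← ENNReal.tsum_mul_left]
  rw [ENNReal.tsum_comm]
  simp only [mul_assoc]

theorem expect_pure {X : Type*} (a : X) (F : X → ℝ≥0∞) : expect (PMF.pure a) F = F a := by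
  unfold expect
  rw [tsum_eq_single a]
  · simp
  · intro b hb
    simp [PMF.pure_apply, hb]

theorem expect_map {X Y : Type*} (p : PMF X) (f : X → Y) (F : Y → ℝ≥0∞) :
    expect (p.map f) F = expect p fun a => F (f a) := by
  rw [← PMF.bind_pure_comp, expect_bind]
  simp [expect_pure]

theorem expect_mono {X : Type*} (p : PMF X) {F G : X → ℝ≥0∞} (h : ∀ a ∈ p.support, F a ≤ G a) :
    expect p F ≤ expect p G := by
  refine ENNReal.tsum_le_tsum fun a => ?_
  by_cases h0 : p a = 0
  · simp [h0]
  · gcongr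
    exact h a ((p.mem_support_iff a).2 h0)

theorem expect_const {X : Type*} (p : PMF X) (r : ℝ≥0∞) : expect p (fun _ => r) = r := by
  unfold expect
  rw [ENNReal.tsum_mul_right, p.tsum_coe, one_mul]

theorem expect_mul_const {X : Type*} (p : PMF X) (F : X → ℝ≥0∞) (r : ℝ≥0∞) :
    expect p (fun a => F a * r) = expect p F * r := by
  unfold expect
  simp only [← mul_assoc]
  rw [ENNReal.tsum_mul_right]

/-- Markov's inequality for exponential moments. -/
theorem toOuterMeasure_le_of_expect_exp {X : Type*} (p : PMF X) (N : X → ℝ) (s : Set X)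
    (K r : ℝ) (hs : ∀ a ∈ s, r ≤ N a)
    (h : expect p (fun a => ENNReal.ofReal (Real.exp (N a))) ≤ ENNReal.ofReal (Real.exp K)) :
    p.toOuterMeasure s ≤ ENNReal.ofReal (Real.exp (K - r)) := by
  have h1 : p.toOuterMeasure s
      ≤ expect p (fun a => ENNReal.ofReal (Real.exp (N a))) * ENNReal.ofReal (Real.exp (-r)) := by
    rw [← expect_mul_const, PMF.toOuterMeasure_apply]
    refine ENNReal.tsum_le_tsum fun a => ?_
    by_cases ha : a ∈ s
    · beta_reduce
      rw [Set.indicator_of_mem ha, ← ENNReal.ofReal_mul (Real.exp_pos _).le, ← Real.exp_add]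
      calc p a = p a * ENNReal.ofReal (Real.exp 0) := by simp
        _ ≤ _ := by
          gcongr
          linarith [hs a ha]
    · rw [Set.indicator_of_notMem ha]
      exact zero_le
  refine h1.trans ?_
  calc _ ≤ ENNReal.ofReal (Real.exp K) * ENNReal.ofReal (Real.exp (-r)) := by gcongr
    _ = _ := by
      rw [← ENNReal.ofReal_mul (Real.exp_pos _).le, ← Real.exp_add, sub_eq_add_neg]

/-- The exponential moment of the number of hits of a random function with independent uniformly
distributed values. -/
theorem expect_exp_hits {I J V : Type*} [Fintype I] [DecidableEq I] [Fintype J] [DecidableEq J]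
    [Fintype V] [DecidableEq V] [Nonempty V]
    (S : Finset (I × J)) (Y : I → J → Finset V) (p θ : ℝ)
    (hY : ∀ e ∈ S, ((Y e.1 e.2).card : ℝ) ≤ p * Fintype.card V) :
    expect (PMF.uniformOfFintype (I → J → V)) (fun f => ENNReal.ofReal (Real.exp
      (θ * ((S.filter fun e => f e.1 e.2 ∈ Y e.1 e.2).card : ℝ))))
      ≤ ENNReal.ofReal (Real.exp (p * Real.exp θ * S.card)) := by
  -- The moment factorizes over the pairs `(i, j)`. A factor in `S` has mean at most `1 + p e^θ ≤
  -- exp (p e^θ)`.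
  set g : I → J → V → ℝ := fun i j v => if (i, j) ∈ S ∧ v ∈ Y i j then Real.exp θ else 1 with hg
  have hexp : ∀ f : I → J → V,
      Real.exp (θ * ((S.filter fun e => f e.1 e.2 ∈ Y e.1 e.2).card : ℝ))
        = ∏ i, ∏ j, g i j (f i j) := by
    intro f
    rw [← Fintype.prod_prod_type' (fun i j => g i j (f i j)), hg]
    simp only
    rw [Finset.prod_ite, Finset.prod_const, Finset.prod_const_one, mul_one, mul_comm,
      Real.exp_nat_mul]
    congr 2
    ext e
    simp
  have hV : (0 : ℝ) < Fintype.card V := by exact_mod_cast Fintype.card_pos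
  have hg1 : ∀ i j, ∑ v, g i j v
      ≤ Fintype.card V * (if (i, j) ∈ S then Real.exp (p * Real.exp θ) else 1) := by
    intro i j
    by_cases hS : (i, j) ∈ S
    · have h1 : ∀ v, g i j v ≤ 1 + if v ∈ Y i j then Real.exp θ else 0 := by
        intro v
        simp only [hg, hS, true_and]
        split_ifs <;> linarith
      rw [if_pos hS]
      calc ∑ v, g i j v ≤ ∑ v, (1 + if v ∈ Y i j then Real.exp θ else 0) :=
            Finset.sum_le_sum fun v _ => h1 v
        _ = Fintype.card V + (Y i j).card * Real.exp θ := by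
            rw [Finset.sum_add_distrib]
            simp
        _ ≤ Fintype.card V + (p * Fintype.card V) * Real.exp θ := by
            gcongr
            exact hY _ hS
        _ = Fintype.card V * (p * Real.exp θ + 1) := by ring
        _ ≤ _ := by
            gcongr
            exact Real.add_one_le_exp _
    · simp [hg, hS]
  have hg0 : ∀ i j, 0 ≤ ∑ v, g i j v := fun i j => Finset.sum_nonneg fun v _ => by
    simp only [hg]; split_ifs <;> positivity
  have hsum : ∑ f : I → J → V, ∏ i, ∏ j, g i j (f i j)
      ≤ (Fintype.card (I → J → V) : ℝ) * Real.exp (p * Real.exp θ * S.card) := by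
    have e1 : ∑ f : I → J → V, ∏ i, ∏ j, g i j (f i j) = ∏ i, ∏ j, ∑ v, g i j v := by
      simp only [Finset.prod_univ_sum, Fintype.piFinset_univ]
    rw [e1]
    calc ∏ i, ∏ j, ∑ v, g i j v
        ≤ ∏ i, ∏ j, (Fintype.card V * (if (i, j) ∈ S then Real.exp (p * Real.exp θ) else 1) : ℝ) :=
          Finset.prod_le_prod (fun i _ => Finset.prod_nonneg fun j _ => hg0 i j) fun i _ =>
            Finset.prod_le_prod (fun j _ => hg0 i j) fun j _ => hg1 i j
      _ = (∏ _i : I, ∏ _j : J, (Fintype.card V : ℝ))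
          * ∏ i, ∏ j, (if (i, j) ∈ S then Real.exp (p * Real.exp θ) else 1) := by
          simp only [Finset.prod_mul_distrib]
      _ = _ := by
          rw [← Fintype.prod_prod_type'
            (fun i j => if (i, j) ∈ S then Real.exp (p * Real.exp θ) else 1)]
          congr 1
          · simp
          · simp [mul_comm _ (S.card : ℝ), Real.exp_nat_mul]
  have hF : (0 : ℝ) < Fintype.card (I → J → V) := by exact_mod_cast Fintype.card_pos
  unfold expect
  rw [tsum_fintype]
  simp only [PMF.uniformOfFintype_apply, hexp]
  rw [← Finset.mul_sum, ← ENNReal.ofReal_sum_of_nonneg]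
  · have : ((Fintype.card (I → J → V) : ℝ≥0∞))⁻¹
        = ENNReal.ofReal ((Fintype.card (I → J → V) : ℝ)⁻¹) := by
      rw [ENNReal.ofReal_inv_of_pos hF, ENNReal.ofReal_natCast]
    rw [this, ← ENNReal.ofReal_mul (by positivity)]
    apply ENNReal.ofReal_le_ofReal
    rw [inv_mul_le_iff₀ hF]
    exact hsum
  · intro f _
    exact Finset.prod_nonneg fun i _ => Finset.prod_nonneg fun j _ => by
      simp only [hg]; split_ifs <;> positivity

/-- A Chernoff bound for the number of hits of a random function with independent uniformly
distributed values. -/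
theorem uniform_hits_le {I J V : Type*} [Fintype I] [DecidableEq I] [Fintype J] [DecidableEq J]
    [Fintype V] [DecidableEq V] [Nonempty V]
    (S : Finset (I × J)) (Y : I → J → Finset V) (p θ r : ℝ) (hθ : 0 ≤ θ)
    (hY : ∀ e ∈ S, ((Y e.1 e.2).card : ℝ) ≤ p * Fintype.card V) :
    (PMF.uniformOfFintype (I → J → V)).toOuterMeasure
      {f | r ≤ ((S.filter fun e => f e.1 e.2 ∈ Y e.1 e.2).card : ℝ)}
      ≤ ENNReal.ofReal (Real.exp (p * Real.exp θ * S.card - θ * r)) :=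
  toOuterMeasure_le_of_expect_exp _ _ _ _ _
    (fun _ hf => mul_le_mul_of_nonneg_left hf hθ) (expect_exp_hits S Y p θ hY)

open Outcome

variable {P : Params}

/-! ### Classes of servers -/

theorem card_agree (p : Fin P.d → Prop) [DecidablePred p] (x : Server P)
    [DecidablePred fun y : Server P => ∀ i, p i → y i = x i] :
    (Finset.univ.filter fun y : Server P => ∀ i, p i → y i = x i).card
      = P.k ^ (Finset.univ.filter fun i => ¬ p i).card := by
  have : (Finset.univ.filter fun y : Server P => ∀ i, p i → y i = x i)
      = Fintype.piFinset fun i => if p i then {x i} else Finset.univ := by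
    ext y
    simp only [Finset.mem_filter, Finset.mem_univ, true_and, Fintype.mem_piFinset]
    refine forall_congr' fun i => ?_
    split_ifs with h <;> simp [h]
  rw [this, Fintype.card_piFinset]
  have h2 : ∀ i, (if p i then {x i} else Finset.univ : Finset (Fin P.k)).card
      = if ¬ p i then P.k else 1 := by
    intro i
    split_ifs <;> simp
  simp only [h2]
  rw [Finset.prod_ite]
  simp

theorem card_filter_val_lt {d ℓ : ℕ} (h : ℓ ≤ d) :
    (Finset.univ.filter fun i : Fin d => (i : ℕ) < ℓ).card = ℓ := by
  rw [Fin.card_filter_val_lt]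
  omega

/-- The representative of the servers that agree with `x` in the coordinates `ℓ, ℓ + 1, …`. -/
def root (ℓ : ℕ) (x : Server P) : Server P := pathNode (Classical.arbitrary _) x ℓ

theorem root_eq_root_iff {ℓ : ℕ} {x y : Server P} :
    root ℓ x = root ℓ y ↔ ∀ i : Fin P.d, ℓ ≤ (i : ℕ) → x i = y i := by
  constructor
  · intro h i hi
    have := congrFun h i
    simpa [root, pathNode, Nat.not_lt.2 hi] using this
  · intro h
    funext i
    by_cases hi : (i : ℕ) < ℓ
    · simp [root, pathNode, hi]
    · simpa [root, pathNode, hi] using h i (Nat.le_of_not_lt hi)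

theorem mem_subBF {ℓ : ℕ} {x y : Server P} : y ∈ subBF ℓ x ↔ root ℓ y = root ℓ x := by
  simp [subBF, root_eq_root_iff]

theorem root_pathNode (ℓ : ℕ) (s h : Server P) : root ℓ (pathNode s h ℓ) = root ℓ h := by
  rw [root_eq_root_iff]
  intro i hi
  simp [pathNode, Nat.not_lt.2 hi]

theorem root_eq_of_le {ℓ j : ℕ} (h : ℓ ≤ j) {x y : Server P} (hxy : root ℓ x = root ℓ y) :
    root j x = root j y := by
  rw [root_eq_root_iff] at *
  exact fun i hi => hxy i (h.trans hi)

open scoped Classical in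
theorem card_root_eq {ℓ : ℕ} (h : ℓ ≤ P.d) (x : Server P) :
    (Finset.univ.filter fun y : Server P => root ℓ y = root ℓ x).card = P.k ^ ℓ := by
  simp only [root_eq_root_iff]
  rw [card_agree (P := P) (fun i => ℓ ≤ (i : ℕ))]
  simp only [not_le]
  rw [card_filter_val_lt h]

open scoped Classical in
theorem card_agree_lt {ℓ : ℕ} (h : ℓ ≤ P.d) (x : Server P) :
    (Finset.univ.filter fun y : Server P => ∀ i : Fin P.d, (i : ℕ) < ℓ → y i = x i).card
      = P.k ^ (P.d - ℓ) := by
  rw [card_agree (P := P) (fun i => (i : ℕ) < ℓ)]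
  congr 1
  rw [Finset.filter_not, Finset.card_sdiff_of_subset (Finset.filter_subset _ _),
    card_filter_val_lt h]
  simp

theorem card_server : Fintype.card (Server P) = P.n := by
  simp [Params.n]

open scoped Classical in
theorem card_preimage_root_le {ℓ : ℕ} (h : ℓ ≤ P.d) (Y : Finset (Server P)) :
    (Finset.univ.filter fun y : Server P => root ℓ y ∈ Y).card ≤ Y.card * P.k ^ ℓ := by
  rw [Finset.card_eq_sum_card_fiberwise (f := root ℓ) (t := Y)]
  · rw [← smul_eq_mul]
    refine Finset.sum_le_card_nsmul _ _ _ fun y _ => ?_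
    by_cases hy : ∃ x, root ℓ x = y
    · obtain ⟨x, rfl⟩ := hy
      rw [← card_root_eq h x]
      exact Finset.card_le_card fun z hz => by simp_all
    -- Members of `Y` need not be representatives; the others have an empty fibre.
    · push Not at hy
      rw [Finset.filter_false_of_mem (fun x _ => hy x)]
      simp
  · intro x hx
    simpa using hx

-- Double counting: distinct classes have disjoint fibres. All bounds on numbers of bad classes rest
-- on this.
open scoped Classical in
theorem card_mul_le_of_roots {E : Type*} {ℓ : ℕ} (Y : Finset (Server P)) (S : Finset E)
    (f : E → Server P) (w : ℝ)
    (h : ∀ y ∈ Y, w ≤ ((S.filter fun e => root ℓ (f e) = y).card : ℝ)) :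
    Y.card * w ≤ S.card := by
  have h1 : ∑ y ∈ Y, (S.filter fun e => root ℓ (f e) = y).card ≤ S.card := by
    rw [Finset.sum_card_fiberwise_eq_card_filter]
    exact Finset.card_filter_le _ _
  calc Y.card * w = ∑ y ∈ Y, w := by simp
    _ ≤ ∑ y ∈ Y, ((S.filter fun e => root ℓ (f e) = y).card : ℝ) := Finset.sum_le_sum h
    _ ≤ _ := by exact_mod_cast h1

open scoped Classical in
/-- The number of pieces, stored at the servers `h i`, in the classes given by `Y`. -/
def hits (Y : Finset (Server P)) (ℓ : ℕ) (h : Fin P.c → Server P) : ℕ :=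
  (Finset.univ.filter fun i => root ℓ (h i) ∈ Y).card

open scoped Classical in
/-- The classes of level `ℓ` in which `X` may prevent the distributed decoding. -/
def crit (X : Finset (Server P)) (ℓ : ℕ) : Finset (Server P) :=
  Finset.univ.filter fun y =>
    2 ^ ℓ ≤ 2 * (X.filter fun x => root ℓ x = y).card

theorem card_crit_mul_le (X : Finset (Server P)) (ℓ : ℕ) :
    ((crit X ℓ).card : ℝ) * (2 ^ ℓ / 2) ≤ X.card := by
  classical
  refine card_mul_le_of_roots (ℓ := ℓ) _ _ id _ fun y hy => ?_
  simp only [crit, Finset.mem_filter, Finset.mem_univ, true_and] at hy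
  have : (2 : ℝ) ^ ℓ ≤ 2 * ((X.filter fun x => root ℓ x = y).card : ℝ) := by exact_mod_cast hy
  simp only [id]
  linarith

/-- A set of crashed servers is too small for a noticeable fraction of critical classes. -/
theorem card_crit_le (hk : 36 ≤ P.k) (X : Finset (Server P))
    (hX : (X.card : ℝ) < gamma / 2 * 2 ^ P.d) {ℓ : ℕ} (hℓ : ℓ ≤ P.d) :
    ((crit X ℓ).card : ℝ) ≤ Real.exp (-12) * P.k ^ (P.d - ℓ) := by
  have h1 := card_crit_mul_le X ℓ
  obtain ⟨j, hj⟩ : ∃ j, P.d = ℓ + j := ⟨P.d - ℓ, by omega⟩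
  have hj' : P.d - ℓ = j := by omega
  rw [hj']
  rw [hj, pow_add] at hX
  have h2l : (0 : ℝ) < 2 ^ ℓ := by positivity
  -- As `γ = 1 / 36`, a nonempty `crit X ℓ` forces `2 ^ j > 36`. The gap between `2 ^ j` and `k ^ j
  -- ≥ 32 ^ j` is then at least `36 ^ 4 ≥ e¹²`.
  have h2 : ((crit X ℓ).card : ℝ) < gamma * 2 ^ j := by
    by_contra hcon
    push Not at hcon
    nlinarith
  rcases Nat.eq_zero_or_pos (crit X ℓ).card with h0 | h0
  · rw [h0, Nat.cast_zero]
    positivity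
  have h3 : (36 : ℝ) ≤ 2 ^ j := by
    have : (1 : ℝ) ≤ (crit X ℓ).card := by exact_mod_cast h0
    unfold gamma at h2
    linarith
  have h4 : Real.exp 12 ≤ 36 ^ 4 := by
    have := Real.exp_one_lt_d9
    have e : Real.exp 12 = Real.exp 1 ^ 12 := by rw [← Real.exp_nat_mul]; norm_num
    rw [e]
    calc Real.exp 1 ^ 12 ≤ 3 ^ 12 := by gcongr; linarith
      _ ≤ _ := by norm_num
  have h5 : (2 : ℝ) ^ j * (2 ^ j) ^ 4 ≤ P.k ^ j := by
    rw [← pow_succ', ← pow_mul, mul_comm, pow_mul]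
    gcongr
    have : (36 : ℝ) ≤ P.k := by exact_mod_cast hk
    norm_num
    linarith
  have h6 : (36 : ℝ) ^ 4 ≤ (2 ^ j) ^ 4 := by gcongr
  rw [Real.exp_neg, inv_mul_eq_div, le_div_iff₀ (Real.exp_pos _)]
  have h7 : ((crit X ℓ).card : ℝ) ≤ 2 ^ j := by
    unfold gamma at h2
    linarith
  calc ((crit X ℓ).card : ℝ) * Real.exp 12 ≤ 2 ^ j * (2 ^ j) ^ 4 := by
        gcongr
        exact h4.trans h6
    _ ≤ _ := h5

/-! ### Distributed decoding -/

-- An unavailable node has two unavailable neighbours on the next larger level. They differ in the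
-- coordinate changed there, which is fixed in both subtrees above them, so the servers without data
-- found in the two subtrees are disjoint and their number doubles.
open scoped Classical in
theorem card_not_good_of_not_available (good : Server P → Prop) {ℓ : ℕ} :
    ∀ (j : ℕ) (x : Server P), j ≤ ℓ → ¬ Available good ℓ j x →
      2 ^ j ≤ (Finset.univ.filter fun y : Server P => ¬ good y ∧
        ∀ i : Fin P.d, ((i : ℕ) < ℓ - j ∨ ℓ ≤ (i : ℕ)) → y i = x i).card := by
  intro j
  induction j with
  | zero =>
    intro x _ hx
    rw [pow_zero, Finset.one_le_card]
    exact ⟨x, by simpa [Available] using hx⟩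
  | succ j ih =>
    intro x hj hx
    simp only [Available, not_or, not_le] at hx
    obtain ⟨y₁, hy₁, y₂, hy₂, hne⟩ := Finset.one_lt_card.1 hx.2
    simp only [Finset.mem_filter, Finset.mem_univ, true_and] at hy₁ hy₂
    have b₁ := ih y₁ (by omega) hy₁.2
    have b₂ := ih y₂ (by omega) hy₂.2
    have hd : ∃ i : Fin P.d, (i : ℕ) = ℓ - (j + 1) ∧ y₁ i ≠ y₂ i := by
      by_contra hcon
      push Not at hcon
      apply hne
      funext i
      by_cases hi : (i : ℕ) = ℓ - (j + 1)
      · exact hcon i hi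
      · rw [hy₁.1 i hi, hy₂.1 i hi]
    obtain ⟨i₀, hi₀, hne₀⟩ := hd
    rw [pow_succ, mul_two]
    refine (Nat.add_le_add b₁ b₂).trans ?_
    rw [← Finset.card_union_of_disjoint]
    · refine Finset.card_le_card fun y hy => ?_
      simp only [Finset.mem_union, Finset.mem_filter, Finset.mem_univ, true_and] at hy ⊢
      rcases hy with ⟨hg, hy⟩ | ⟨hg, hy⟩
      · refine ⟨hg, fun i hi => ?_⟩
        rw [hy i (by omega), hy₁.1 i (by omega)]
      · refine ⟨hg, fun i hi => ?_⟩
        rw [hy i (by omega), hy₂.1 i (by omega)]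
    · rw [Finset.disjoint_left]
      intro y h1 h2
      simp only [Finset.mem_filter, Finset.mem_univ, true_and] at h1 h2
      apply hne₀
      rw [← h1.2 i₀ (by omega), ← h2.2 i₀ (by omega)]

/-- The decoding succeeds, unless one of two sets of servers that cover the servers without data is
critical. -/
theorem available_of_notMem_crit (good : Server P → Prop) {ℓ : ℕ} (hℓ : ℓ ≤ P.d)
    (X₁ X₂ : Finset (Server P)) (hX : ∀ x, ¬ good x → x ∈ X₁ ∨ x ∈ X₂) (x : Server P)
    (h₁ : root ℓ x ∉ crit X₁ ℓ) (h₂ : root ℓ x ∉ crit X₂ ℓ) :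
    (∃ y, root ℓ y = root ℓ x ∧ good y) ∧ Available good ℓ ℓ x := by
  classical
  simp only [crit, Finset.mem_filter, Finset.mem_univ, true_and, not_le] at h₁ h₂
  have key : (Finset.univ.filter fun y : Server P => ¬ good y ∧ root ℓ y = root ℓ x).card
      < 2 ^ ℓ := by
    have : (Finset.univ.filter fun y : Server P => ¬ good y ∧ root ℓ y = root ℓ x)
        ⊆ (X₁.filter fun y => root ℓ y = root ℓ x) ∪ (X₂.filter fun y => root ℓ y = root ℓ x) := by
      intro y hy
      simp only [Finset.mem_union, Finset.mem_filter, Finset.mem_univ, true_and] at hy ⊢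
      rcases hX y hy.1 with h | h
      · exact Or.inl ⟨h, hy.2⟩
      · exact Or.inr ⟨h, hy.2⟩
    -- The threshold in `crit` is half of `2 ^ ℓ`, so two noncritical sets together stay below `2 ^
    -- ℓ`.
    have := (Finset.card_le_card this).trans (Finset.card_union_le _ _)
    omega
  constructor
  · by_contra hcon
    push Not at hcon
    apply key.not_ge
    calc 2 ^ ℓ ≤ P.k ^ ℓ := Nat.pow_le_pow_left P.two_le_k _
      _ = _ := (card_root_eq hℓ x).symm
      _ ≤ _ := Finset.card_le_card fun y hy => by
        simp only [Finset.mem_filter, Finset.mem_univ, true_and] at hy ⊢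
        exact ⟨hcon y hy, hy⟩
  · by_contra hcon
    apply key.not_ge
    refine (card_not_good_of_not_available good ℓ x le_rfl hcon).trans ?_
    refine Finset.card_le_card fun y hy => ?_
    simp only [Finset.mem_filter, Finset.mem_univ, true_and] at hy ⊢
    exact ⟨hy.1, root_eq_root_iff.2 fun i hi => hy.2 i (Or.inr hi)⟩

/-! ### The latest version of a bucket -/

open scoped Classical in
/-- The number of the last period in which the bucket was encoded (`0` if there is none). -/
def latest : History P → Bucket P → ℕ
  | [], _ => 0
  | p :: past, b => if ∃ D, p.move.encoded = some (b, D) then past.length + 1 else latest past b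

open scoped Classical in
/-- The servers that were crashed when the bucket was last encoded. -/
def outdated : History P → Bucket P → Finset (Server P)
  | [], _ => ∅
  | p :: past, b => if ∃ D, p.move.encoded = some (b, D) then p.move.crashed else outdated past b

theorem latest_le_length (H : History P) (b : Bucket P) : latest H b ≤ H.length := by
  induction H with
  | nil => simp [latest]
  | cons p past ih =>
    simp only [latest, List.length_cons]
    split_ifs <;> omega

theorem stamp_le_latest (H : History P) (x : Server P) (b : Bucket P) :
    stamp H x b ≤ latest H b := by
  induction H with
  | nil => simp [stamp]
  | cons p past ih =>
    have := latest_le_length past b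
    simp only [stamp, latest]
    split_ifs with h1 h2 h2
    · exact le_rfl
    · exact absurd h1.1 h2
    · omega
    · exact ih

theorem stamp_eq_latest (H : History P) (x : Server P) (b : Bucket P) (hx : x ∉ outdated H b) :
    stamp H x b = latest H b := by
  induction H with
  | nil => simp [stamp, latest]
  | cons p past ih =>
    simp only [stamp, latest, outdated] at hx ⊢
    by_cases h : ∃ D, p.move.encoded = some (b, D)
    · simp only [h, if_true] at hx
      simp [h, hx]
    · simp only [h, if_false] at hx
      simp [h, ih hx]

theorem outdated_card_lt (H : History P) (b : Bucket P) :
    ((outdated H b).card : ℝ) < gamma / 2 * 2 ^ P.d := by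
  induction H with
  | nil => simp [outdated, gamma]
  | cons p past ih =>
    simp only [outdated]
    split_ifs
    · exact p.move.crashed_lt
    · exact ih

/-- The hash functions of a period are good, if they send few pieces of any data item to classes
in which the servers that are crashed at that time may prevent the decoding. -/
def GoodPeriod (p : Period P) : Prop :=
  ∀ ℓ ≤ P.d, ∀ a : Key P, 6 * hits (crit p.move.crashed ℓ) ℓ (p.hash a) ≤ P.c

/-- The outdated servers are those crashed in the very period whose hash functions are in use, so
`GoodPeriod` of that period applies. -/
theorem hits_crit_outdated_le (H : History P) (hH : ∀ p ∈ H, GoodPeriod p) (b : Bucket P)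
    (hb : 0 < latest H b) {ℓ : ℕ} (hℓ : ℓ ≤ P.d) (a : Key P) :
    6 * hits (crit (outdated H b) ℓ) ℓ (hashAt H (latest H b) a) ≤ P.c := by
  induction H with
  | nil => simp [latest] at hb
  | cons p past ih =>
    have h1 := latest_le_length past b
    by_cases h : ∃ D, p.move.encoded = some (b, D)
    · simp only [latest, outdated, hashAt, h, if_true]
      exact hH p (by simp) ℓ hℓ a
    · simp only [latest, h, if_false] at hb
      simp only [latest, outdated, hashAt, h, if_false,
        if_neg (show latest past b ≠ past.length + 1 by omega)]
      exact ih (fun p hp => hH p (by simp [hp])) hb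

/-! ### Data items with many pieces in few classes -/

/-- The servers that store the pieces of the data item `a`. -/
def place (H : History P) (a : Key P) : Fin P.c → Server P :=
  hashAt H (latest H (bucketOf a)) a

/-- The hash functions expand: few data items have many pieces in a small set of classes. -/
def Expands (H : History P) (ℓ : ℕ) : Prop :=
  ∀ Y : Finset (Server P), (Y.card : ℝ) ≤ Real.exp (-12) * P.k ^ (P.d - ℓ) →
    ∀ S : Finset (ℕ × Key P),
      (∀ e ∈ S, 1 ≤ e.1 ∧ e.1 ≤ H.length ∧ P.c < 6 * hits Y ℓ (hashAt H e.1 e.2)) →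
      (S.card : ℝ) ≤ gamma * P.k ^ (P.d - ℓ)

open scoped Classical in
/-- The data items that have been encoded and have many pieces in the classes given by `Y`. -/
def lossy (H : History P) (Y : Finset (Server P)) (ℓ : ℕ) : Finset (Key P) :=
  Finset.univ.filter fun a => 0 < latest H (bucketOf a) ∧ P.c < 6 * hits Y ℓ (place H a)

theorem card_lossy_le {H : History P} {ℓ : ℕ} (hH : Expands H ℓ) (Y : Finset (Server P))
    (hY : (Y.card : ℝ) ≤ Real.exp (-12) * P.k ^ (P.d - ℓ)) :
    ((lossy H Y ℓ).card : ℝ) ≤ gamma * P.k ^ (P.d - ℓ) := by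
  classical
  have h := hH Y hY ((lossy H Y ℓ).image fun a => (latest H (bucketOf a), a)) (by
    intro e he
    obtain ⟨a, ha, rfl⟩ := Finset.mem_image.1 he
    simp only [lossy, Finset.mem_filter, Finset.mem_univ, true_and] at ha
    exact ⟨ha.1, latest_le_length _ _, ha.2⟩)
  rwa [Finset.card_image_of_injective] at h
  intro a b hab
  exact (Prod.mk.inj hab).2

theorem hits_le_of_notMem_lossy {H : History P} {Y : Finset (Server P)} {ℓ : ℕ} {a : Key P}
    (ha : 0 < latest H (bucketOf a)) (h : a ∉ lossy H Y ℓ) :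
    6 * hits Y ℓ (place H a) ≤ P.c := by
  simp only [lossy, Finset.mem_filter, Finset.mem_univ, true_and, not_and, not_lt] at h
  exact h ha

-- This is the count `5/6 - 3 · 1/6 = 1/3` behind the number of pieces required.
open scoped Classical in
theorem le_card_filter_notMem (A : Finset (Fin P.c)) (hA : 5 * P.c ≤ 6 * A.card)
    (h : Fin P.c → Server P) (ℓ : ℕ) (Y₁ Y₂ Y₃ : Finset (Server P))
    (h₁ : 6 * hits Y₁ ℓ h ≤ P.c) (h₂ : 6 * hits Y₂ ℓ h ≤ P.c) (h₃ : 6 * hits Y₃ ℓ h ≤ P.c) :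
    P.c ≤ 3 * (A.filter fun i =>
      root ℓ (h i) ∉ Y₁ ∧ root ℓ (h i) ∉ Y₂ ∧ root ℓ (h i) ∉ Y₃).card := by
  set G := A.filter fun i => root ℓ (h i) ∉ Y₁ ∧ root ℓ (h i) ∉ Y₂ ∧ root ℓ (h i) ∉ Y₃
  have hsub : A ⊆ G ∪ ((Finset.univ.filter fun i => root ℓ (h i) ∈ Y₁) ∪
      ((Finset.univ.filter fun i => root ℓ (h i) ∈ Y₂) ∪
        (Finset.univ.filter fun i => root ℓ (h i) ∈ Y₃))) := by
    intro i hi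
    simp only [G, Finset.mem_union, Finset.mem_filter, Finset.mem_univ, true_and, hi]
    tauto
  have h4 := (Finset.card_le_card hsub).trans (Finset.card_union_le _ _)
  have h5 := Finset.card_union_le (Finset.univ.filter fun i => root ℓ (h i) ∈ Y₁)
      ((Finset.univ.filter fun i => root ℓ (h i) ∈ Y₂) ∪
        (Finset.univ.filter fun i => root ℓ (h i) ∈ Y₃))
  have h6 := Finset.card_union_le (Finset.univ.filter fun i => root ℓ (h i) ∈ Y₂)
        (Finset.univ.filter fun i => root ℓ (h i) ∈ Y₃)
  simp only [hits] at h₁ h₂ h₃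
  omega

namespace Outcome

variable (o : Outcome P)

/-! ### Overloaded classes in the Probing Stage -/

open scoped Classical in
/-- The number of probes with a destination in the class of `x`. -/
def load (ℓ : ℕ) (x : Server P) : ℕ :=
  (Finset.univ.filter fun e : Server P × Fin P.c =>
    o.Live e.1 ∧ root ℓ (o.dest e.1 e.2) = root ℓ x).card

/-- There are too many probes with a destination in the class of `x`. -/
def Overloaded (ℓ : ℕ) (x : Server P) : Prop :=
  Real.exp 12 * P.c * P.k ^ ℓ < o.load ℓ x

open scoped Classical in
/-- The starting points of the probes distribute the load of a class evenly. -/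
def Spread : Prop :=
  ∀ ℓ ≤ P.d, ∀ x : Server P, ¬ o.Overloaded ℓ x →
    ((Finset.univ.filter fun e : Server P × Fin P.c =>
      o.Live e.1 ∧ o.node e.1 e.2 ℓ = x).card : ℝ) ≤ 7 * Real.exp 12 * P.c

/-- All requests use the latest version of the bucket. -/
def Synced : Prop := ∀ s, o.time s = latest o.hist (bucketOf (o.batch.item s))

variable {o}

theorem Overloaded.congr {ℓ : ℕ} {x y : Server P} (h : o.Overloaded ℓ x)
    (hxy : root ℓ x = root ℓ y) : o.Overloaded ℓ y := by
  unfold Overloaded load at *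
  rwa [← hxy]

variable (o)

open scoped Classical in
/-- The servers in a class of level at least `ℓ` that is overloaded. -/
def overloadedAbove (ℓ : ℕ) : Finset (Server P) :=
  Finset.univ.filter fun x => ∃ j, ℓ ≤ j ∧ j ≤ P.d ∧ o.Overloaded j x

open scoped Classical in
/-- A maximal inequality: the overloaded classes of all levels cover few servers. -/
theorem card_overloadedAbove_le (hc : 0 < P.c) (ℓ : ℕ) :
    Real.exp 12 * ((o.overloadedAbove ℓ).card : ℝ) ≤ P.n := by
  -- Covering each server by its class at the largest overloaded level makes the covering classes
  -- disjoint, so no probe is charged twice. The value `0` for servers that are never overloaded is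
  -- harmless, as only `overloadedAbove` is counted.
  set J : Server P → ℕ := fun x => Nat.findGreatest (fun j => o.Overloaded j x) P.d with hJ
  have hJd : ∀ x, J x ≤ P.d := fun x => Nat.findGreatest_le _
  have hJinv : ∀ x y, o.Overloaded (J x) x → root (J x) x = root (J x) y → J y = J x := by
    intro x y hx hxy
    have hy := hx.congr hxy
    have h1 : J x ≤ J y := Nat.le_findGreatest (hJd x) hy
    refine le_antisymm ?_ h1
    have h2 : o.Overloaded (J y) y :=
      Nat.findGreatest_spec (P := fun j => o.Overloaded j y) (hJd x) hy
    exact Nat.le_findGreatest (hJd y) (h2.congr (root_eq_of_le h1 hxy.symm))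
  set E : Finset (Server P × Fin P.c) := Finset.univ.filter fun e => o.Live e.1 with hE
  have hEcard : (E.card : ℝ) ≤ P.n * P.c := by
    have : E.card ≤ P.n * P.c := by
      refine (Finset.card_le_univ _).trans ?_
      rw [Fintype.card_prod, card_server, Fintype.card_fin]
    exact_mod_cast this
  have hlev : ∀ j ∈ Finset.range (P.d + 1),
      Real.exp 12 * P.c * (((o.overloadedAbove ℓ).filter fun x => J x = j).card : ℝ)
        ≤ ((E.filter fun e => J (o.dest e.1 e.2) = j).card : ℝ) := by
    intro j hj
    have hjd : j ≤ P.d := Nat.lt_succ_iff.1 (Finset.mem_range.1 hj)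
    set U := (o.overloadedAbove ℓ).filter fun x => J x = j with hU
    have hUo : ∀ x ∈ U, J x = j ∧ o.Overloaded j x := by
      intro x hx
      simp only [hU, overloadedAbove, Finset.mem_filter, Finset.mem_univ, true_and] at hx
      obtain ⟨⟨i, -, hid, hi⟩, hxj⟩ := hx
      refine ⟨hxj, ?_⟩
      rw [← hxj]
      exact Nat.findGreatest_spec (P := fun j => o.Overloaded j x) hid hi
    have h1 : (U.card : ℝ) ≤ (U.image (root j)).card * (P.k : ℝ) ^ j := by
      have : U.card ≤ (U.image (root j)).card * P.k ^ j := by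
        refine le_trans (Finset.card_le_card fun x hx => ?_)
          (card_preimage_root_le hjd (U.image (root j)))
        simp only [Finset.mem_filter, Finset.mem_univ, true_and]
        exact Finset.mem_image_of_mem _ hx
      exact_mod_cast this
    have h2 : ((U.image (root j)).card : ℝ) * (Real.exp 12 * P.c * P.k ^ j)
        ≤ ((E.filter fun e => J (o.dest e.1 e.2) = j).card : ℝ) := by
      refine card_mul_le_of_roots (ℓ := j) _ _ (fun e => o.dest e.1 e.2) _ fun y hy => ?_
      obtain ⟨x, hx, rfl⟩ := Finset.mem_image.1 hy
      obtain ⟨hxj, hxo⟩ := hUo x hx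
      refine hxo.le.trans ?_
      norm_cast
      refine Finset.card_le_card fun e he => ?_
      simp only [hE, Finset.mem_filter, Finset.mem_univ, true_and] at he ⊢
      refine ⟨⟨he.1, ?_⟩, he.2⟩
      -- `J` is constant on the class, so all probes headed for it are charged to level `j`.
      have := hJinv x (o.dest e.1 e.2) (by rwa [hxj]) (by rw [hxj, he.2])
      rw [this, hxj]
    calc Real.exp 12 * P.c * (U.card : ℝ)
        ≤ Real.exp 12 * P.c * ((U.image (root j)).card * (P.k : ℝ) ^ j) := by gcongr
      _ = ((U.image (root j)).card : ℝ) * (Real.exp 12 * P.c * P.k ^ j) := by ring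
      _ ≤ _ := h2
  have hsumU : (((o.overloadedAbove ℓ).card : ℕ) : ℝ)
      = ∑ j ∈ Finset.range (P.d + 1),
        (((o.overloadedAbove ℓ).filter fun x => J x = j).card : ℝ) := by
    rw [Finset.card_eq_sum_card_fiberwise (f := J) (t := Finset.range (P.d + 1))]
    · push_cast
      rfl
    · intro x _
      simpa [Nat.lt_succ_iff] using hJd x
  have hsumE : ∑ j ∈ Finset.range (P.d + 1),
      ((E.filter fun e => J (o.dest e.1 e.2) = j).card : ℝ) ≤ E.card := by
    have : ∑ j ∈ Finset.range (P.d + 1),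
        (E.filter fun e => J (o.dest e.1 e.2) = j).card ≤ E.card := by
      rw [Finset.sum_card_fiberwise_eq_card_filter]
      exact Finset.card_filter_le _ _
    exact_mod_cast this
  have hfin : Real.exp 12 * P.c * ((o.overloadedAbove ℓ).card : ℝ) ≤ P.n * P.c := by
    rw [hsumU, Finset.mul_sum]
    exact (Finset.sum_le_sum hlev).trans (hsumE.trans hEcard)
  have hc' : (0 : ℝ) < P.c := by exact_mod_cast hc
  refine le_of_mul_le_mul_right ?_ hc'
  linarith

theorem n_eq_mul {ℓ : ℕ} (hℓ : ℓ ≤ P.d) : (P.n : ℝ) = P.k ^ ℓ * P.k ^ (P.d - ℓ) := by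
  rw [← pow_add, Nat.add_sub_cancel' hℓ]
  simp [Params.n]

theorem k_pos : (0 : ℝ) < P.k := by
  have := P.two_le_k
  exact_mod_cast (by omega : 0 < P.k)

open scoped Classical in
/-- The classes of level `ℓ` in which probes may be stopped at a level that is at least `ℓ`. -/
def jammed (ℓ : ℕ) : Finset (Server P) := (o.overloadedAbove ℓ).image (root ℓ)

/-- A class overloaded at a level `j ≥ ℓ` is a union of classes of level `ℓ`. Hence jammed classes
lie entirely in `overloadedAbove`, and the maximal inequality is divided by `k ^ ℓ`. -/
theorem card_jammed_le (hc : 0 < P.c) {ℓ : ℕ} (hℓ : ℓ ≤ P.d) :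
    ((o.jammed ℓ).card : ℝ) ≤ Real.exp (-12) * P.k ^ (P.d - ℓ) := by
  classical
  have h1 := o.card_overloadedAbove_le hc ℓ
  have h2 : ((o.jammed ℓ).card : ℝ) * (P.k : ℝ) ^ ℓ ≤ (o.overloadedAbove ℓ).card := by
    refine card_mul_le_of_roots (ℓ := ℓ) _ _ id _ fun y hy => ?_
    obtain ⟨x, hx, rfl⟩ := Finset.mem_image.1 hy
    rw [← Nat.cast_pow, ← card_root_eq hℓ x]
    norm_cast
    refine Finset.card_le_card fun z hz => ?_
    simp only [overloadedAbove, Finset.mem_filter, Finset.mem_univ, true_and, id] at hx hz ⊢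
    obtain ⟨j, hj, hjd, hxj⟩ := hx
    exact ⟨⟨j, hj, hjd, hxj.congr (root_eq_of_le hj hz.symm)⟩, hz⟩
  have hk : (0 : ℝ) < (P.k : ℝ) ^ ℓ := pow_pos k_pos _
  rw [n_eq_mul hℓ] at h1
  rw [Real.exp_neg, inv_mul_eq_div, le_div_iff₀ (Real.exp_pos _)]
  refine le_of_mul_le_mul_right ?_ hk
  nlinarith [Real.exp_pos 12]

theorem not_overloaded_of_notMem_jammed {ℓ j : ℕ} (hℓ : ℓ ≤ j) (hj : j ≤ P.d) {x : Server P}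
    (hx : root ℓ x ∉ o.jammed ℓ) : ¬ o.Overloaded j x := by
  classical
  intro h
  apply hx
  refine Finset.mem_image_of_mem _ ?_
  simp only [overloadedAbove, Finset.mem_filter, Finset.mem_univ, true_and]
  exact ⟨j, hℓ, hj, h⟩

variable {o}

theorem Arrives.live {α : ℝ} {j : ℕ} {s : Server P} {i : Fin P.c} (h : o.Arrives α j s i) :
    o.Live s := by
  induction j with
  | zero => exact h
  | succ j ih => exact ih h.1

theorem Arrives.mono {α : ℝ} {j j' : ℕ} (hj : j ≤ j') {s : Server P} {i : Fin P.c}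
    (h : o.Arrives α j' s i) : o.Arrives α j s i := by
  induction hj with
  | refl => exact h
  | step _ ih => exact ih h.1

theorem active_subset {α : ℝ} {ℓ ℓ' : ℕ} (h : ℓ ≤ ℓ') (s : Server P) :
    o.active α ℓ s ⊆ o.active α ℓ' s := by
  intro i hi
  simp only [active, Finset.mem_filter, Finset.mem_univ, true_and] at hi ⊢
  exact hi.mono (by omega)

/-- Down to level `ℓ`, every node of the path lies in the destination's class of its level, which is
not overloaded. `Spread` then keeps the node below `αc` even if no probe was stopped earlier. The
bound `d - ℓ + 1` includes passing level `ℓ` itself. -/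
theorem arrives_of_notMem_jammed (hS : o.Spread) {α : ℝ} (hα : 7 * Real.exp 12 ≤ α) {ℓ : ℕ}
    (hℓ : ℓ ≤ P.d) {s : Server P} (hs : o.Live s) {i : Fin P.c}
    (hi : root ℓ (o.dest s i) ∉ o.jammed ℓ) :
    ∀ j ≤ P.d - ℓ + 1, o.Arrives α j s i := by
  classical
  intro j
  induction j with
  | zero => exact fun _ => hs
  | succ j ih =>
    intro hj
    refine ⟨ih (by omega), ?_⟩
    rw [not_lt]
    have h1 : ¬ o.Overloaded (P.d - j) (o.node s i (P.d - j)) := by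
      intro h
      refine o.not_overloaded_of_notMem_jammed (by omega) (Nat.sub_le _ _) hi (h.congr ?_)
      exact root_pathNode _ _ _
    have h2 := hS (P.d - j) (Nat.sub_le _ _) _ h1
    have h3 : (o.msgsAt (o.Arrives α j) (P.d - j) (o.node s i (P.d - j))).card
        ≤ (Finset.univ.filter fun e : Server P × Fin P.c =>
          o.Live e.1 ∧ o.node e.1 e.2 (P.d - j) = o.node s i (P.d - j)).card := by
      refine Finset.card_image_le.trans (Finset.card_le_card fun e he => ?_)
      simp only [Finset.mem_filter, Finset.mem_univ, true_and] at he ⊢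
      exact ⟨he.1.live, he.2⟩
    calc _ ≤ ((Finset.univ.filter fun e : Server P × Fin P.c =>
          o.Live e.1 ∧ o.node e.1 e.2 (P.d - j) = o.node s i (P.d - j)).card : ℝ) := by
          exact_mod_cast h3
      _ ≤ 7 * Real.exp 12 * P.c := h2
      _ ≤ α * P.c := by gcongr

theorem Synced.dest_eq (hT : o.Synced) (s : Server P) :
    o.dest s = place o.hist (o.batch.item s) := by
  funext i
  rw [dest, hT s, place]

theorem Synced.latest_pos (hT : o.Synced) {s : Server P} (hs : o.Live s) :
    0 < latest o.hist (bucketOf (o.batch.item s)) := hT s ▸ hs.2.2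

/-- A live request most of whose probes do not head for jammed classes of level `ℓ` has many active
probes at level `ℓ`. -/
theorem le_card_active (hT : o.Synced) (hS : o.Spread) {α : ℝ} (hα : 7 * Real.exp 12 ≤ α) {ℓ : ℕ}
    (hℓ : ℓ ≤ P.d) {s : Server P} (hs : o.Live s)
    (hl : o.batch.item s ∉ lossy o.hist (o.jammed ℓ) ℓ) :
    5 * P.c ≤ 6 * (o.active α ℓ s).card := by
  classical
  have h1 := hits_le_of_notMem_lossy (hT.latest_pos hs) hl
  rw [← hT.dest_eq] at h1
  have h2 : (Finset.univ : Finset (Fin P.c)) ⊆ o.active α ℓ s ∪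
      Finset.univ.filter fun i => root ℓ (o.dest s i) ∈ o.jammed ℓ := by
    intro i _
    simp only [active, Finset.mem_union, Finset.mem_filter, Finset.mem_univ, true_and]
    by_cases hi : root ℓ (o.dest s i) ∈ o.jammed ℓ
    · exact Or.inr hi
    · exact Or.inl (arrives_of_notMem_jammed hS hα hℓ hs hi _ le_rfl)
  have h3 := (Finset.card_le_card h2).trans (Finset.card_union_le _ _)
  rw [Finset.card_univ, Fintype.card_fin] at h3
  unfold hits at h1
  omega

/-! ### Congestion in the Decoding Stage -/

open scoped Classical in
/-- The classes of level `ℓ` that receive many pieces of the data items in `B`. -/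
def congested (H : History P) (B : Finset (Key P)) (β : ℝ) (ℓ : ℕ) : Finset (Server P) :=
  Finset.univ.filter fun y => β * P.c * P.k <
    (((B ×ˢ (Finset.univ : Finset (Fin P.c))).filter fun e =>
      root ℓ (place H e.1 e.2) = y).card : ℝ)

/-- The factor `k` in the congestion threshold absorbs the factor `k` in the number of items allowed
at level `ℓ`. -/
theorem card_congested_le (H : History P) (B : Finset (Key P)) {β : ℝ} (hβ : Real.exp 12 ≤ β)
    (hc : 0 < P.c) {ℓ : ℕ} (hB : (B.card : ℝ) ≤ P.k * P.k ^ (P.d - ℓ)) :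
    ((congested H B β ℓ).card : ℝ) ≤ Real.exp (-12) * P.k ^ (P.d - ℓ) := by
  classical
  have h1 : ((congested H B β ℓ).card : ℝ) * (β * P.c * P.k)
      ≤ (B ×ˢ (Finset.univ : Finset (Fin P.c))).card := by
    refine card_mul_le_of_roots (ℓ := ℓ) _ _ (fun e => place H e.1 e.2) _ fun y hy => ?_
    simp only [congested, Finset.mem_filter, Finset.mem_univ, true_and] at hy
    exact hy.le
  rw [Finset.card_product, Finset.card_univ, Fintype.card_fin] at h1
  push_cast at h1
  have hc' : (0 : ℝ) < P.c := by exact_mod_cast hc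
  have hk : (0 : ℝ) < P.k := k_pos
  rw [Real.exp_neg, inv_mul_eq_div, le_div_iff₀ (Real.exp_pos _)]
  refine le_of_mul_le_mul_right ?_ (mul_pos hc' hk)
  calc ((congested H B β ℓ).card : ℝ) * Real.exp 12 * (P.c * P.k)
      ≤ ((congested H B β ℓ).card : ℝ) * β * (P.c * P.k) := by gcongr
    _ = ((congested H B β ℓ).card : ℝ) * (β * P.c * P.k) := by ring
    _ ≤ B.card * P.c := h1
    _ ≤ (P.k * P.k ^ (P.d - ℓ)) * P.c := by gcongr
    _ = _ := by ring

/-- Edges below level `ℓ` change only coordinates smaller than `ℓ`, so forwarding never takes a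
message out of its class of level `ℓ`. Every node of the sub-butterfly thus sees at most the
messages of that one class. -/
theorem Synced.received_subset (hT : o.Synced) {β : ℝ}
    {sel : ℕ → Server P → Finset (Fin P.c)} {R : Server P → Prop} {B : Finset (Key P)}
    (hR : ∀ s, R s → o.batch.item s ∈ B) {ℓ : ℕ} :
    ∀ j ≤ ℓ, ∀ u, o.received β sel R ℓ j u ⊆
      ((B ×ˢ (Finset.univ : Finset (Fin P.c))).filter fun e =>
        root ℓ (place o.hist e.1 e.2) = root ℓ u).image
          fun e => (e.1, e.2, latest o.hist (bucketOf e.1)) := by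
  intro j
  induction j with
  | zero =>
    intro _ u m hm
    simp only [received, msgsAt, Finset.mem_image, Finset.mem_filter, Finset.mem_univ,
      true_and] at hm
    obtain ⟨⟨s, i⟩, ⟨⟨hs, -⟩, rfl⟩, rfl⟩ := hm
    simp only [Finset.mem_image, Finset.mem_filter, Finset.mem_product, Finset.mem_univ, and_true]
    refine ⟨(o.batch.item s, i), ⟨hR s hs, ?_⟩, ?_⟩
    · rw [node, root_pathNode, hT.dest_eq]
    · rw [msg, hT s]
  | succ j ih =>
    intro hj u m hm
    simp only [received, Finset.mem_biUnion, Finset.mem_filter, Finset.mem_univ, true_and] at hm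
    obtain ⟨v, ⟨hv, -⟩, hm⟩ := hm
    have h := ih (by omega) v hm
    have hr : root ℓ v = root ℓ u := root_eq_root_iff.2 fun i hi => hv i (by omega)
    rwa [hr] at h

theorem congestionFree_of_notMem (hT : o.Synced) {β : ℝ}
    {sel : ℕ → Server P → Finset (Fin P.c)} {R : Server P → Prop} {B : Finset (Key P)}
    (hR : ∀ s, R s → o.batch.item s ∈ B) {ℓ : ℕ} {v : Server P}
    (hv : root ℓ v ∉ congested o.hist B β ℓ) : o.CongestionFree β sel R ℓ v := by
  classical
  have key : ∀ j ≤ ℓ, ∀ u, root ℓ u = root ℓ v →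
      ((o.received β sel R ℓ j u).card : ℝ) ≤ β * P.c * P.k := by
    intro j hj u hu
    simp only [congested, Finset.mem_filter, Finset.mem_univ, true_and, not_lt] at hv
    rw [← hu] at hv
    refine le_trans ?_ hv
    have := (Finset.card_le_card (hT.received_subset (β := β) (sel := sel) hR j hj u)).trans
      Finset.card_image_le
    exact_mod_cast this
  exact ⟨key 0 (Nat.zero_le _) v rfl, fun j _ hj u hu => key j hj.le u (mem_subBF.1 hu)⟩

/-! ### One sub-phase -/

theorem upToDate_of_notMem (hT : o.Synced) (s x : Server P) (h : ¬ o.UpToDate s x) :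
    x ∈ crashedNow o.hist ∨ x ∈ outdated o.hist (bucketOf (o.batch.item s)) := by
  by_contra hcon
  push Not at hcon
  exact h ⟨hcon.1, by rw [hT s, stamp_eq_latest _ _ _ hcon.2]⟩

theorem Belongs.live {α β : ℝ} {sel : ℕ → Server P → Finset (Fin P.c)} {ℓ : ℕ} {s : Server P}
    (h : o.Belongs α β sel ℓ s) : o.Live s := by
  induction ℓ with
  | zero => exact h.elim
  | succ ℓ ih =>
    rcases h with h | h
    · exact h.1
    · exact ih h.1

theorem Belongs.le_card_active {α β : ℝ} {sel : ℕ → Server P → Finset (Fin P.c)} {ℓ : ℕ}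
    {s : Server P} (h : o.Belongs α β sel ℓ s) : 5 * P.c ≤ 6 * (o.active α ℓ s).card := by
  induction ℓ with
  | zero => exact h.elim
  | succ ℓ ih =>
    rcases h with h | h
    · exact h.2.2.1.2.2
    · refine (ih h.1).trans ?_
      gcongr
      exact active_subset (Nat.le_succ ℓ) s

theorem probed_of_notMem (hT : o.Synced) (hG : ∀ p ∈ o.hist, GoodPeriod p) (hc : 0 < P.c)
    {α : ℝ} {s : Server P} (hs : o.Live s) (hA : 5 * P.c ≤ 6 * (o.active α 0 s).card)
    (h : o.batch.item s ∉ lossy o.hist (crit (crashedNow o.hist) 0) 0) : o.Probed α s := by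
  classical
  have hpos := hT.latest_pos hs
  have h1 := hits_le_of_notMem_lossy hpos h
  have h2 := hits_crit_outdated_le o.hist hG _ hpos (Nat.zero_le P.d) (o.batch.item s)
  -- Classes of level `0` are single servers, where `Available` just means up to date. There is no
  -- congestion to account for, hence `∅`.
  have h3 := le_card_filter_notMem _ hA _ 0 _ _ ∅ h1 h2 (by simp [hits])
  have hsub : ((o.active α 0 s).filter fun i =>
      root 0 (place o.hist (o.batch.item s) i) ∉ crit (crashedNow o.hist) 0 ∧
      root 0 (place o.hist (o.batch.item s) i)
        ∉ crit (outdated o.hist (bucketOf (o.batch.item s))) 0 ∧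
      root 0 (place o.hist (o.batch.item s) i) ∉ (∅ : Finset (Server P)))
      ⊆ o.answered α s := by
    intro i hi
    simp only [answered, Finset.mem_filter] at hi ⊢
    refine ⟨hi.1, ?_⟩
    have := (available_of_notMem_crit (o.UpToDate s) (Nat.zero_le P.d) _ _
      (upToDate_of_notMem hT s) _ hi.2.1 hi.2.2.1).2
    rw [hT.dest_eq]
    exact this
  have h4 := Finset.card_le_card hsub
  by_cases hst : o.Stored s
  · exact Or.inl ⟨hst, h3.trans (by gcongr)⟩
  · refine Or.inr ⟨hst, ?_⟩
    rw [← Finset.card_pos]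
    omega

theorem recovered_of_notMem (hT : o.Synced) (hG : ∀ p ∈ o.hist, GoodPeriod p) (hc : 0 < P.c)
    {β : ℝ} {sel : ℕ → Server P → Finset (Fin P.c)} {R : Server P → Prop} {B : Finset (Key P)}
    (hR : ∀ s, R s → o.batch.item s ∈ B) {ℓ : ℕ} (hℓ : ℓ ≤ P.d) {s : Server P} (hs : o.Live s)
    (hA : 5 * P.c ≤ 6 * (sel ℓ s).card)
    (h : o.batch.item s ∉ lossy o.hist (crit (crashedNow o.hist) ℓ) ℓ)
    (h' : o.batch.item s ∉ lossy o.hist (congested o.hist B β ℓ) ℓ) :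
    o.Recovered β sel R ℓ s := by
  classical
  have hpos := hT.latest_pos hs
  have h1 := hits_le_of_notMem_lossy hpos h
  have h2 := hits_crit_outdated_le o.hist hG _ hpos hℓ (o.batch.item s)
  have h3 := le_card_filter_notMem _ hA _ ℓ _ _ _ h1 h2 (hits_le_of_notMem_lossy hpos h')
  set G := ((sel ℓ s).filter fun i =>
      root ℓ (place o.hist (o.batch.item s) i) ∉ crit (crashedNow o.hist) ℓ ∧
      root ℓ (place o.hist (o.batch.item s) i)
        ∉ crit (outdated o.hist (bucketOf (o.batch.item s))) ℓ ∧
      root ℓ (place o.hist (o.batch.item s) i) ∉ congested o.hist B β ℓ)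
  have hgood : ∀ i ∈ G, i ∈ sel ℓ s ∧ o.CongestionFree β sel R ℓ (o.node s i ℓ) ∧
      (∃ x ∈ subBF ℓ (o.node s i ℓ), o.UpToDate s x) ∧
      Available (o.UpToDate s) ℓ ℓ (o.dest s i) := by
    intro i hi
    simp only [G, Finset.mem_filter] at hi
    have hr : root ℓ (o.node s i ℓ) = root ℓ (place o.hist (o.batch.item s) i) := by
      rw [node, root_pathNode, hT.dest_eq]
    have h5 := available_of_notMem_crit (o.UpToDate s) hℓ _ _
      (upToDate_of_notMem hT s) _ hi.2.1 hi.2.2.1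
    refine ⟨hi.1, congestionFree_of_notMem hT hR (by rw [hr]; exact hi.2.2.2), ?_, ?_⟩
    · obtain ⟨x, hx, hxu⟩ := h5.1
      exact ⟨x, mem_subBF.2 (hx.trans hr.symm), hxu⟩
    · rw [hT.dest_eq]
      exact h5.2
  by_cases hst : o.Stored s
  · refine Or.inl ⟨hst, h3.trans ?_⟩
    gcongr
    intro i hi
    have := hgood i hi
    exact Finset.mem_filter.2 ⟨this.1, this.2.1, this.2.2.2⟩
  · have : 0 < G.card := by omega
    obtain ⟨i, hi⟩ := Finset.card_pos.1 this
    have := hgood i hi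
    exact Or.inr ⟨hst, i, this.1, this.2.1, this.2.2.1⟩

variable {α β : ℝ} {sel : ℕ → Server P → Finset (Fin P.c)}

/-- Outside the jammed case `5c / 6` probes are active at level `ℓ`. A declaration for `ℓ + 1` then
contradicts minimality or, for `ℓ = 0`, the failure of the Probing Stage; a request left over from
level `ℓ` would have been recovered. -/
theorem itemsAtLevel_succ_subset (hT : o.Synced) (hS : o.Spread)
    (hG : ∀ p ∈ o.hist, GoodPeriod p)
    (hc : 0 < P.c) (hα : 7 * Real.exp 12 ≤ α) (hsel : o.Selection α sel) {ℓ : ℕ} (hℓ : ℓ < P.d) :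
    o.itemsAtLevel α β sel (ℓ + 1) ⊆ lossy o.hist (o.jammed ℓ) ℓ ∪
      (lossy o.hist (crit (crashedNow o.hist) ℓ) ℓ ∪
        lossy o.hist (congested o.hist (o.itemsAtLevel α β sel ℓ) β ℓ) ℓ) := by
  classical
  intro a ha
  simp only [itemsAtLevel, Finset.mem_image, Finset.mem_filter, Finset.mem_univ, true_and] at ha
  obtain ⟨s, hb, rfl⟩ := ha
  have hs := hb.live
  by_contra hcon
  simp only [Finset.mem_union, not_or] at hcon
  obtain ⟨hj, hcr, hco⟩ := hcon
  have hact := le_card_active (α := α) hT hS hα hℓ.le hs hj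
  rcases hb with hd | ⟨hb, hnr⟩
  · rcases Nat.eq_zero_or_pos ℓ with h0 | h0
    · subst h0
      exact hd.2.1 (probed_of_notMem hT hG hc hs hact hcr)
    · have := hd.2.2.2 ⟨h0, hℓ.le, hact⟩
      omega
  · apply hnr
    refine recovered_of_notMem hT hG hc (B := o.itemsAtLevel α β sel ℓ) ?_ hℓ.le hs ?_ hcr hco
    · intro s' hs'
      simp only [itemsAtLevel, Finset.mem_image, Finset.mem_filter, Finset.mem_univ, true_and]
      exact ⟨s', hs', rfl⟩
    · rw [(hsel ℓ s hb.le_card_active).2]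
      omega

theorem phi_mul_div {ℓ : ℕ} (hℓ : ℓ < P.d) :
    P.phi * P.n / (P.k : ℝ) ^ (ℓ + 1) = 3 * gamma * P.k ^ (P.d - ℓ) := by
  have hk : (0 : ℝ) < P.k := k_pos
  rw [div_eq_iff (by positivity), n_eq_mul hℓ.le, Params.phi]
  ring

theorem card_itemsAtLevel_le (hT : o.Synced) (hS : o.Spread)
    (hG : ∀ p ∈ o.hist, GoodPeriod p) (hE : ∀ ℓ < P.d, Expands o.hist ℓ)
    (hc : 0 < P.c) (hk : 36 ≤ P.k) (hα : 7 * Real.exp 12 ≤ α) (hβ : Real.exp 12 ≤ β)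
    (hsel : o.Selection α sel) :
    ∀ ℓ < P.d, ((o.itemsAtLevel α β sel (ℓ + 1)).card : ℝ) ≤ 3 * gamma * P.k ^ (P.d - ℓ) := by
  classical
  have hB : ∀ ℓ < P.d, ((o.itemsAtLevel α β sel ℓ).card : ℝ) ≤ P.k * P.k ^ (P.d - ℓ) →
      ((o.itemsAtLevel α β sel (ℓ + 1)).card : ℝ) ≤ 3 * gamma * P.k ^ (P.d - ℓ) := by
    intro ℓ hℓ hcard
    have h1 := (Finset.card_le_card
      (itemsAtLevel_succ_subset (β := β) hT hS hG hc hα hsel hℓ)).trans (Finset.card_union_le _ _)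
    have h2 := Finset.card_union_le (lossy o.hist (crit (crashedNow o.hist) ℓ) ℓ)
      (lossy o.hist (congested o.hist (o.itemsAtLevel α β sel ℓ) β ℓ) ℓ)
    have h3 := (h1.trans (Nat.add_le_add_left h2 _))
    have h4 : ((o.itemsAtLevel α β sel (ℓ + 1)).card : ℝ)
        ≤ (lossy o.hist (o.jammed ℓ) ℓ).card +
          ((lossy o.hist (crit (crashedNow o.hist) ℓ) ℓ).card +
          (lossy o.hist (congested o.hist (o.itemsAtLevel α β sel ℓ) β ℓ) ℓ).card) := by
      exact_mod_cast h3
    have e1 := card_lossy_le (hE ℓ hℓ) _ (o.card_jammed_le hc hℓ.le)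
    have e2 := card_lossy_le (hE ℓ hℓ) _ (card_crit_le hk _ (crashedNow_card_lt o.hist) hℓ.le)
    have e3 := card_lossy_le (hE ℓ hℓ) _ (card_congested_le o.hist _ hβ hc hcard)
    linarith
  intro ℓ
  induction ℓ with
  | zero =>
    intro hℓ
    refine hB 0 hℓ ?_
    have : o.itemsAtLevel α β sel 0 = ∅ :=
      Finset.image_eq_empty.2 (Finset.filter_false_of_mem fun _ _ h => h)
    rw [this, Finset.card_empty, Nat.cast_zero]
    positivity
  | succ ℓ ih =>
    intro hℓ
    -- Only congestion needs the previous level; the weak bound `3γ ≤ 1` is enough, so the estimate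
    -- does not deteriorate.
    refine hB (ℓ + 1) hℓ ((ih (by omega)).trans ?_)
    have : P.d - ℓ = (P.d - (ℓ + 1)) + 1 := by omega
    rw [this, pow_succ']
    have h0 : (0 : ℝ) ≤ P.k * P.k ^ (P.d - (ℓ + 1)) := by positivity
    unfold gamma
    linarith

end Outcome

/-! ### Probability bounds -/

/-- A union bound restricted to the support, so that facts such as the length of a random history
may be used. -/
theorem toOuterMeasure_exists_le {X I : Type*} (p : PMF X) (S : Finset I) (F : I → Set X)
    (ε : ℝ) (h : ∀ i ∈ S, p.toOuterMeasure (F i) ≤ ENNReal.ofReal ε) (s : Set X)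
    (hs : s ∩ p.support ⊆ {a | ∃ i ∈ S, a ∈ F i}) :
    p.toOuterMeasure s ≤ ENNReal.ofReal (S.card * ε) := by
  have h1 : s ∩ p.support ⊆ ⋃ i ∈ S, F i := by
    intro a ha
    obtain ⟨i, hi, hai⟩ := hs ha
    exact Set.mem_biUnion hi hai
  calc p.toOuterMeasure s ≤ p.toOuterMeasure (⋃ i ∈ S, F i) := p.toOuterMeasure_mono h1
    _ ≤ ∑ i ∈ S, p.toOuterMeasure (F i) := MeasureTheory.measure_biUnion_finset_le _ _
    _ ≤ ∑ i ∈ S, ENNReal.ofReal ε := Finset.sum_le_sum h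
    _ = _ := by
      rw [Finset.sum_const, nsmul_eq_mul, ENNReal.ofReal_mul (Nat.cast_nonneg _),
        ENNReal.ofReal_natCast]

open scoped Classical in
theorem card_preimage_root_le_exp {ℓ : ℕ} (hℓ : ℓ ≤ P.d) (Y : Finset (Server P))
    (hY : (Y.card : ℝ) ≤ Real.exp (-12) * P.k ^ (P.d - ℓ)) :
    ((Finset.univ.filter fun y : Server P => root ℓ y ∈ Y).card : ℝ)
      ≤ Real.exp (-12) * Fintype.card (Server P) := by
  have h1 : ((Finset.univ.filter fun y : Server P => root ℓ y ∈ Y).card : ℝ)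
      ≤ Y.card * P.k ^ ℓ := by exact_mod_cast card_preimage_root_le hℓ Y
  rw [card_server, n_eq_mul hℓ]
  refine h1.trans ?_
  calc (Y.card : ℝ) * P.k ^ ℓ ≤ (Real.exp (-12) * P.k ^ (P.d - ℓ)) * P.k ^ ℓ := by gcongr
    _ = _ := by ring

open scoped Classical in
theorem sum_hits_eq (D : Finset (Key P)) (Y : Finset (Server P)) (ℓ : ℕ)
    (h : Key P → Fin P.c → Server P) :
    ∑ a ∈ D, hits Y ℓ (h a) = ((D ×ˢ (Finset.univ : Finset (Fin P.c))).filter fun e =>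
      h e.1 e.2 ∈ Finset.univ.filter fun y : Server P => root ℓ y ∈ Y).card := by
  rw [Finset.card_filter, Finset.sum_product]
  refine Finset.sum_congr rfl fun a _ => ?_
  rw [hits, Finset.card_filter]
  simp

/-- At exponent `12` the density `e⁻¹²` cancels, leaving `c` per item. More than `c / 6` hits
contribute over `12 · c / 6 = 2c`, so Markov's inequality gains `e⁻ᶜ` per item. -/
theorem expect_exp_sum_hits {ℓ : ℕ} (hℓ : ℓ ≤ P.d) (Y : Finset (Server P))
    (hY : (Y.card : ℝ) ≤ Real.exp (-12) * P.k ^ (P.d - ℓ)) (D : Finset (Key P)) :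
    expect (PMF.uniformOfFintype (Key P → Fin P.c → Server P)) (fun h => ENNReal.ofReal
      (Real.exp (12 * ((∑ a ∈ D, hits Y ℓ (h a) : ℕ) : ℝ))))
      ≤ ENNReal.ofReal (Real.exp (D.card * P.c)) := by
  classical
  have h := expect_exp_hits (I := Key P) (J := Fin P.c) (V := Server P) (D ×ˢ Finset.univ)
    (fun _ _ => Finset.univ.filter fun y : Server P => root ℓ y ∈ Y) (Real.exp (-12)) 12
    (fun _ _ => card_preimage_root_le_exp hℓ Y hY)
  rw [← Real.exp_add, neg_add_cancel, Real.exp_zero, one_mul, Finset.card_product,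
    Finset.card_univ, Fintype.card_fin, Nat.cast_mul] at h
  simp only [sum_hits_eq]
  convert h using 10

theorem not_goodPeriod_le (hk : 36 ≤ P.k) (mv : Move P) :
    (PMF.uniformOfFintype (Key P → Fin P.c → Server P)).toOuterMeasure
      {h | ¬ GoodPeriod ⟨mv, h⟩}
      ≤ ENNReal.ofReal ((P.d + 1) * P.m * Real.exp (-P.c)) := by
  have h := toOuterMeasure_exists_le
    (PMF.uniformOfFintype (Key P → Fin P.c → Server P))
    (Finset.range (P.d + 1) ×ˢ (Finset.univ : Finset (Key P)))
    (fun e => {h | P.c < 6 * hits (crit mv.crashed e.1) e.1 (h e.2)}) (Real.exp (-P.c)) ?_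
    {h | ¬ GoodPeriod ⟨mv, h⟩} ?_
  · rw [Finset.card_product, Finset.card_range, Finset.card_univ] at h
    simpa [Params.m] using h
  · rintro ⟨ℓ, a⟩ he
    have hℓ : ℓ ≤ P.d := by simpa [Nat.lt_succ_iff] using he
    have := toOuterMeasure_le_of_expect_exp _ _
      {h : Key P → Fin P.c → Server P | P.c < 6 * hits (crit mv.crashed ℓ) ℓ (h a)} _
      (2 * P.c) (fun h hh => ?_)
      (expect_exp_sum_hits hℓ (crit mv.crashed ℓ) (card_crit_le hk _ mv.crashed_lt hℓ) {a})
    · refine this.trans (le_of_eq ?_)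
      rw [Finset.card_singleton]
      congr 2
      push_cast
      ring
    · rw [Finset.sum_singleton]
      have : (P.c : ℝ) < 6 * hits (crit mv.crashed ℓ) ℓ (h a) := by exact_mod_cast hh
      linarith
  · rintro h ⟨hh, -⟩
    simp only [GoodPeriod, Set.mem_ofPred_eq] at hh
    push Not at hh
    obtain ⟨ℓ, hℓ, a, ha⟩ := hh
    exact ⟨(ℓ, a), by simpa [Nat.lt_succ_iff] using hℓ, ha⟩

theorem not_goodPeriods_le (hk : 36 ≤ P.k) (A : Adversary P) (T : ℕ) :
    (randomHistory A T).toOuterMeasure {H | ¬ ∀ p ∈ H, GoodPeriod p}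
      ≤ ENNReal.ofReal (T * ((P.d + 1) * P.m * Real.exp (-P.c))) := by
  induction T with
  | zero =>
    rw [randomHistory, Nat.cast_zero, zero_mul, ENNReal.ofReal_zero, nonpos_iff_eq_zero,
      PMF.toOuterMeasure_apply_eq_zero_iff]
    simp
  | succ T ih =>
    rw [randomHistory]
    push_cast
    rw [add_one_mul, ENNReal.ofReal_add (by positivity) (by positivity)]
    refine (toOuterMeasure_bind_le_add _ _ _ {H | ¬ ∀ p ∈ H, GoodPeriod p} _
      fun H _ hH => ?_).trans (add_le_add_left ih _)
    -- The crashed servers are fixed before the hash functions are drawn.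
    refine toOuterMeasure_bind_le _ _ _ _ fun mv _ => ?_
    rw [PMF.toOuterMeasure_map_apply]
    refine le_trans (PMF.toOuterMeasure_mono _ ?_) (not_goodPeriod_le hk mv)
    rintro h ⟨hh, -⟩
    simp only [Set.mem_ofPred_eq, not_not] at hH
    simp only [Set.mem_preimage, Set.mem_ofPred_eq, List.mem_cons, forall_eq_or_imp, not_and_or]
      at hh ⊢
    rcases hh with hh | hh
    · exact hh
    · exact absurd hH hh

theorem length_of_mem_support (A : Adversary P) (T : ℕ) (H : History P)
    (hH : H ∈ (randomHistory A T).support) : H.length = T := by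
  induction T generalizing H with
  | zero =>
    simp only [randomHistory, PMF.support_pure, Set.mem_singleton_iff] at hH
    simp [hH]
  | succ T ih =>
    simp only [randomHistory, PMF.mem_support_bind_iff, PMF.mem_support_map_iff] at hH
    obtain ⟨H', hH', mv, -, h, -, rfl⟩ := hH
    simp [ih H' hH']

/-- The exponential moment of the number of pieces in the classes given by `Y`, for a set of data
items with timestamps. -/
theorem expect_exp_sum_hashAt (A : Adversary P) {ℓ : ℕ} (hℓ : ℓ ≤ P.d) (Y : Finset (Server P))
    (hY : (Y.card : ℝ) ≤ Real.exp (-12) * P.k ^ (P.d - ℓ)) (T : ℕ) :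
    ∀ S : Finset (ℕ × Key P), (∀ e ∈ S, 1 ≤ e.1 ∧ e.1 ≤ T) →
    expect (randomHistory A T) (fun H => ENNReal.ofReal
      (Real.exp (12 * ((∑ e ∈ S, hits Y ℓ (hashAt H e.1 e.2) : ℕ) : ℝ))))
      ≤ ENNReal.ofReal (Real.exp (S.card * P.c)) := by
  classical
  induction T with
  | zero =>
    intro S hS
    have : S = ∅ := Finset.eq_empty_of_forall_notMem fun e he => by
      have := hS e he
      omega
    simp [this, expect_const]
  | succ T ih =>
    intro S hS
    -- Given the past and the move, the fresh hash functions affect only the pairs of period `T +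
    -- 1`. Their moment bound does not depend on the move, so it factors out whatever the adversary
    -- does.
    set S₁ := S.filter fun e => e.1 = T + 1 with hS₁
    set S₂ := S.filter fun e => ¬ e.1 = T + 1 with hS₂
    have hcard : S.card = S₁.card + S₂.card := (Finset.card_filter_add_card_filter_not _).symm
    set D := S₁.image Prod.snd with hD
    have hinj : Set.InjOn Prod.snd (S₁ : Set (ℕ × Key P)) := by
      intro e he e' he' h
      simp only [hS₁, Finset.coe_filter, Set.mem_ofPred_eq] at he he'
      exact Prod.ext (he.2.trans he'.2.symm) h
    have hDcard : D.card = S₁.card := Finset.card_image_of_injOn hinj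
    have hstep : ∀ H ∈ (randomHistory A T).support, ∀ mv h,
        Real.exp (12 * ((∑ e ∈ S, hits Y ℓ (hashAt (⟨mv, h⟩ :: H) e.1 e.2) : ℕ) : ℝ))
        = Real.exp (12 * ((∑ a ∈ D, hits Y ℓ (h a) : ℕ) : ℝ)) *
          Real.exp (12 * ((∑ e ∈ S₂, hits Y ℓ (hashAt H e.1 e.2) : ℕ) : ℝ)) := by
      intro H hH mv h
      have hlen := length_of_mem_support A T H hH
      rw [← Real.exp_add, ← mul_add, ← Nat.cast_add,
        ← Finset.sum_filter_add_sum_filter_not S (fun e => e.1 = T + 1), hD,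
        Finset.sum_image hinj]
      congr 4
      · refine Finset.sum_congr rfl fun e he => ?_
        have := (Finset.mem_filter.1 he).2
        simp [hashAt, hlen, this]
      · refine Finset.sum_congr rfl fun e he => ?_
        have := (Finset.mem_filter.1 he).2
        simp [hashAt, hlen, this]
    rw [randomHistory, expect_bind]
    calc _ ≤ expect (randomHistory A T) (fun H => ENNReal.ofReal
          (Real.exp (12 * ((∑ e ∈ S₂, hits Y ℓ (hashAt H e.1 e.2) : ℕ) : ℝ))) *
          ENNReal.ofReal (Real.exp (D.card * P.c))) := by
          refine expect_mono _ fun H hH => ?_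
          rw [expect_bind]
          refine (expect_mono _ (G := fun _ => _) fun mv _ => ?_).trans
            (expect_const (A.move H) _).le
          rw [expect_map]
          simp only [hstep H hH, ENNReal.ofReal_mul (Real.exp_pos _).le]
          rw [expect_mul_const, mul_comm]
          gcongr
          exact expect_exp_sum_hits hℓ Y hY D
      _ = expect (randomHistory A T) (fun H => ENNReal.ofReal
          (Real.exp (12 * ((∑ e ∈ S₂, hits Y ℓ (hashAt H e.1 e.2) : ℕ) : ℝ)))) *
          ENNReal.ofReal (Real.exp (D.card * P.c)) := expect_mul_const _ _ _
      _ ≤ ENNReal.ofReal (Real.exp (S₂.card * P.c)) *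
          ENNReal.ofReal (Real.exp (D.card * P.c)) := by
          gcongr
          refine ih S₂ fun e he => ?_
          have h1 := Finset.mem_filter.1 he
          have h2 := hS e h1.1
          have h3 := h1.2
          omega
      _ = _ := by
          rw [← ENNReal.ofReal_mul (Real.exp_pos _).le, ← Real.exp_add, hcard, hDcard]
          congr 2
          push_cast
          ring

theorem hits_mono {Y Y' : Finset (Server P)} (h : Y ⊆ Y') (ℓ : ℕ) (f : Fin P.c → Server P) :
    hits Y ℓ f ≤ hits Y' ℓ f := by
  classical
  refine Finset.card_le_card fun i hi => ?_
  simp only [Finset.mem_filter, Finset.mem_univ, true_and] at hi ⊢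
  exact h hi

theorem one_le_k_pow (j : ℕ) : (1 : ℝ) ≤ (P.k : ℝ) ^ j := by
  refine one_le_pow₀ ?_
  have := P.two_le_k
  exact_mod_cast (by omega : 1 ≤ P.k)

theorem not_expands_le (A : Adversary P) (T : ℕ) {ℓ : ℕ} (hℓ : ℓ ≤ P.d)
    (hsmall : (P.n : ℝ) * (T * P.m) * Real.exp (-P.c) ≤ 1) :
    (randomHistory A T).toOuterMeasure {H | ¬ Expands H ℓ}
      ≤ ENNReal.ofReal ((P.n : ℝ) * (T * P.m) * Real.exp (-P.c)) := by
  classical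
  set N : ℝ := (P.k : ℝ) ^ (P.d - ℓ) with hN
  have hN1 : 1 ≤ N := one_le_k_pow _
  have hNn : N ≤ P.n := by
    rw [n_eq_mul hℓ]
    have : (1 : ℝ) ≤ (P.k : ℝ) ^ ℓ := one_le_k_pow _
    nlinarith
  have hγ : (0 : ℝ) ≤ gamma * N := by unfold gamma; positivity
  have he12 : Real.exp (-12) ≤ gamma := by
    have h1 : (36 : ℝ) ≤ Real.exp 12 := by
      have := Real.add_one_le_exp (6 : ℝ)
      have e : Real.exp 12 = Real.exp 6 * Real.exp 6 := by rw [← Real.exp_add]; norm_num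
      rw [e]
      nlinarith
    rw [Real.exp_neg, gamma, one_div]
    exact inv_anti₀ (by norm_num) h1
  -- It suffices to treat sets of exact sizes: enlarging `Y` only increases hits, and `s` is the
  -- least size violating the bound. As `y ≤ s`, the choices of `Y` cost at most `n ^ s`, and the
  -- whole union bound becomes an `s`-th power of a base at most `1`.
  set y := ⌊Real.exp (-12) * N⌋₊ with hy
  set s := ⌊gamma * N⌋₊ + 1 with hs
  have hys : y ≤ s := (Nat.floor_le_floor (by gcongr)).trans (Nat.le_succ _)
  have hyN : (y : ℝ) ≤ Real.exp (-12) * N := Nat.floor_le (by positivity)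
  have hyn : y ≤ Fintype.card (Server P) := by
    rw [card_server]
    have : Real.exp (-12) ≤ 1 := Real.exp_le_one_iff.2 (by norm_num)
    have : (y : ℝ) ≤ P.n := by nlinarith
    exact_mod_cast this
  have hnpos : (1 : ℝ) ≤ P.n := hN1.trans hNn
  set I := (Finset.univ : Finset (Server P)).powersetCard y ×ˢ
    ((Finset.Icc 1 T) ×ˢ (Finset.univ : Finset (Key P))).powersetCard s with hI
  have hIcard : (I.card : ℝ) ≤ (P.n : ℝ) ^ s * (T * P.m : ℝ) ^ s := by
    have h1 : I.card ≤ P.n ^ y * (T * P.m) ^ s := by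
      rw [hI, Finset.card_product, Finset.card_powersetCard, Finset.card_powersetCard,
        Finset.card_univ, card_server, Finset.card_product, Finset.card_univ, Nat.card_Icc,
        Nat.add_sub_cancel]
      have : Fintype.card (Key P) = P.m := by simp [Params.m]
      rw [this]
      exact Nat.mul_le_mul (Nat.choose_le_pow _ _) (Nat.choose_le_pow _ _)
    have h2 : (I.card : ℝ) ≤ (P.n : ℝ) ^ y * (T * P.m : ℝ) ^ s := by exact_mod_cast h1
    refine h2.trans ?_
    gcongr
  have h := toOuterMeasure_exists_le (randomHistory A T) I
    (fun e => {H | ∀ x ∈ e.2, P.c < 6 * hits e.1 ℓ (hashAt H x.1 x.2)})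
    (Real.exp (-P.c) ^ s) ?_ {H | ¬ Expands H ℓ} ?_
  · refine h.trans (ENNReal.ofReal_le_ofReal ?_)
    calc (I.card : ℝ) * Real.exp (-P.c) ^ s
        ≤ ((P.n : ℝ) ^ s * (T * P.m : ℝ) ^ s) * Real.exp (-P.c) ^ s := by gcongr
      _ = ((P.n : ℝ) * (T * P.m) * Real.exp (-P.c)) ^ s := by
          rw [← mul_pow, ← mul_pow]
      _ ≤ ((P.n : ℝ) * (T * P.m) * Real.exp (-P.c)) ^ 1 :=
          pow_le_pow_of_le_one (by positivity) hsmall (by omega)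
      _ = _ := pow_one _
  · rintro ⟨Y, S⟩ he
    simp only [hI, Finset.mem_product, Finset.mem_powersetCard] at he
    obtain ⟨⟨-, hYc⟩, hSsub, hSc⟩ := he
    have := toOuterMeasure_le_of_expect_exp _ _
      {H : History P | ∀ x ∈ S, P.c < 6 * hits Y ℓ (hashAt H x.1 x.2)} _
      (2 * (S.card * P.c)) (fun H hH => ?_)
      (expect_exp_sum_hashAt A hℓ Y (by rw [hYc]; exact hyN) T S fun e he => by
        have := hSsub he
        simp only [Finset.mem_product, Finset.mem_Icc] at this
        exact this.1)
    · refine this.trans (le_of_eq ?_)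
      rw [← Real.exp_nat_mul, hSc]
      congr 2
      ring
    · have h1 : ∑ x ∈ S, P.c ≤ ∑ x ∈ S, 6 * hits Y ℓ (hashAt H x.1 x.2) :=
        Finset.sum_le_sum fun x hx => (hH x hx).le
      rw [Finset.sum_const, smul_eq_mul, ← Finset.mul_sum] at h1
      have h2 : (S.card * P.c : ℝ) ≤ 6 * (∑ x ∈ S, hits Y ℓ (hashAt H x.1 x.2) : ℕ) := by
        exact_mod_cast h1
      linarith
  · rintro H ⟨hH, hsupp⟩
    have hlen := length_of_mem_support A T H hsupp
    simp only [Set.mem_ofPred_eq, Expands] at hH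
    push Not at hH
    obtain ⟨Y, hY, S, hS, hcard⟩ := hH
    obtain ⟨Y', hYY', hY'⟩ := Finset.exists_superset_card_eq (s := Y) (n := y)
      (Nat.le_floor hY) hyn
    have hsS : s ≤ S.card := Nat.succ_le_iff.2 ((Nat.floor_lt hγ).2 hcard)
    obtain ⟨S', hSS', hS'⟩ := Finset.exists_subset_card_eq hsS
    refine ⟨(Y', S'), ?_, fun x hx => ?_⟩
    · simp only [hI, Finset.mem_product, Finset.mem_powersetCard]
      refine ⟨⟨Finset.subset_univ _, hY'⟩, fun x hx => ?_, hS'⟩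
      have := hS x (hSS' hx)
      simp only [Finset.mem_product, Finset.mem_Icc, Finset.mem_univ, and_true]
      exact ⟨this.1, hlen ▸ this.2.1⟩
    · refine (hS x (hSS' hx)).2.2.trans_le ?_
      gcongr
      exact hits_mono hYY' _ _

/-! ### Random choices of the current period -/

theorem card_intact (H : History P) : (P.n : ℝ) / 2 ≤ Fintype.card (Intact H) := by
  classical
  have h1 : Fintype.card (Intact H) = P.n - (crashedNow H).card := by
    rw [Fintype.card_subtype_compl, card_server, Fintype.card_coe]
  have h2 : (crashedNow H).card ≤ P.n := by
    rw [← card_server]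
    exact Finset.card_le_univ _
  have h3 := crashedNow_card_lt H
  have h4 : (2 : ℝ) ^ P.d ≤ P.n := by
    have : 2 ^ P.d ≤ P.n := Nat.pow_le_pow_left P.two_le_k _
    exact_mod_cast this
  rw [h1, Nat.cast_sub h2]
  unfold gamma at h3
  linarith

theorem card_subtype_filter_le {V : Type*} [Fintype V] (p q : V → Prop) [DecidablePred q]
    [Fintype {v // p v}] :
    ((Finset.univ : Finset {v // p v}).filter fun v => q v.1).card
      ≤ (Finset.univ.filter q).card := by
  refine Finset.card_le_card_of_injOn Subtype.val (fun v hv => ?_)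
    (Subtype.val_injective.injOn)
  simpa using hv

/-- It is unlikely that a server only asks servers with an outdated version of a bucket. -/
theorem all_outdated_le (hk : 4 ≤ P.k) (H : History P) (b : Server P → Bucket P) :
    (PMF.uniformOfFintype (Server P → Fin P.q → Intact H)).toOuterMeasure
      {f | ∃ s, ∀ j, (f s j).1 ∈ outdated H (b s)}
      ≤ ENNReal.ofReal (P.n * Real.exp (P.q - Real.log P.n / 2 * P.q)) := by
  classical
  -- Fewer than `2 ^ d ≤ √n = e^θ` servers are outdated since `k ≥ 4`, against at least `n / 2`
  -- intact ones. A random intact server is outdated with probability at most `e^(-θ)`.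
  set θ := Real.log P.n / 2 with hθ
  have hn : (0 : ℝ) < P.n := by
    rw [n_eq_mul (Nat.zero_le _)]
    have := k_pos (P := P)
    positivity
  have hn1 : (1 : ℝ) ≤ P.n := by
    have : 1 ≤ P.n := by exact_mod_cast hn
    exact_mod_cast this
  have hexp : Real.exp θ * Real.exp θ = P.n := by
    rw [← Real.exp_add, hθ, add_halves, Real.exp_log hn]
  have h2 : (2 : ℝ) ^ P.d ≤ Real.exp θ := by
    have h4 : ((2 : ℝ) ^ P.d) ^ 2 ≤ (Real.exp θ) ^ 2 := by
      rw [pow_two (Real.exp θ), hexp, ← pow_mul, mul_comm, pow_mul, Params.n]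
      push_cast
      gcongr
      have : (4 : ℝ) ≤ P.k := by exact_mod_cast hk
      linarith
    exact (pow_le_pow_iff_left₀ (by positivity) (by positivity) two_ne_zero).1 h4
  have h := toOuterMeasure_exists_le
    (PMF.uniformOfFintype (Server P → Fin P.q → Intact H)) Finset.univ
    (fun s => {f | ∀ j, (f s j).1 ∈ outdated H (b s)}) (Real.exp (P.q - θ * P.q)) ?_
    {f | ∃ s, ∀ j, (f s j).1 ∈ outdated H (b s)} ?_
  · rwa [Finset.card_univ, card_server] at h
  · intro s _
    set Y : Finset (Intact H) := Finset.univ.filter fun v => v.1 ∈ outdated H (b s) with hY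
    have hYc : (Y.card : ℝ) ≤ Real.exp (-θ) * Fintype.card (Intact H) := by
      have h5 : (Y.card : ℝ) ≤ (outdated H (b s)).card := by
        have := card_subtype_filter_le (fun x => x ∉ crashedNow H)
          (fun v => v ∈ outdated H (b s))
        rw [Finset.filter_univ_mem] at this
        exact_mod_cast this
      have h6 := outdated_card_lt H (b s)
      have h7 := card_intact H
      unfold gamma at h6
      rw [Real.exp_neg, inv_mul_eq_div, le_div_iff₀ (Real.exp_pos _)]
      have : (Y.card : ℝ) ≤ Real.exp θ / 2 := by linarith
      nlinarith [Real.exp_pos θ]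
    have h8 := uniform_hits_le (I := Server P) (J := Fin P.q) (V := Intact H)
      ({s} ×ˢ Finset.univ) (fun _ _ => Y) (Real.exp (-θ)) θ P.q
      (div_nonneg (Real.log_nonneg hn1) zero_le_two) (fun _ _ => hYc)
    rw [← Real.exp_add, neg_add_cancel, Real.exp_zero, one_mul, Finset.card_product,
      Finset.card_singleton, one_mul, Finset.card_univ, Fintype.card_fin] at h8
    refine le_trans (PMF.toOuterMeasure_mono _ ?_) h8
    rintro f ⟨hf, -⟩
    simp only [Set.mem_ofPred_eq] at hf ⊢
    refine le_trans ?_ (Nat.cast_le.2 (Finset.card_le_card (s := {s} ×ˢ Finset.univ)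
      fun e he => Finset.mem_filter.2 ⟨he, ?_⟩))
    · simp
    · have : e.1 = s := Finset.mem_singleton.1 (Finset.mem_product.1 he).1
      rw [this]
      simpa [hY] using hf e.2
  · rintro f ⟨⟨s, hs⟩, -⟩
    exact ⟨s, Finset.mem_univ _, hs⟩

/-- No timestamp exceeds the latest one, and a single server that is not outdated attains it. -/
theorem Outcome.synced_of_asked (o : Outcome P)
    (h : ∀ s, ∃ j, o.asked s j ∉ outdated o.hist (bucketOf (o.batch.item s))) : o.Synced := by
  intro s
  obtain ⟨j, hj⟩ := h s
  refine le_antisymm (max_le (stamp_le_latest _ _ _)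
    (Finset.sup_le fun j _ => stamp_le_latest _ _ _)) ?_
  rw [← stamp_eq_latest _ _ _ hj]
  exact le_max_of_le_right (Finset.le_sup
    (f := fun j => stamp o.hist (o.asked s j) (bucketOf (o.batch.item s))) (Finset.mem_univ j))

theorem not_spread_le (H : History P) (B : Batch P) (ask : Server P → Fin P.q → Server P) :
    (PMF.uniformOfFintype (Server P → Fin P.c → Intact H)).toOuterMeasure
      {f | ¬ Outcome.Spread
        { hist := H, batch := B, asked := ask, start := fun s i => (f s i).1 }}
      ≤ ENNReal.ofReal ((P.d + 1) * P.n * Real.exp (-P.c)) := by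
  classical
  set mk : (Server P → Fin P.c → Server P) → Outcome P := fun g =>
    { hist := H, batch := B, asked := ask, start := g } with hmk
  -- Destinations, live requests and overload do not depend on the starting points, so any value
  -- serves to state them before these are drawn.
  set o := mk (fun _ _ => Classical.arbitrary _) with ho
  have h := toOuterMeasure_exists_le
    (PMF.uniformOfFintype (Server P → Fin P.c → Intact H))
    ((Finset.range (P.d + 1) ×ˢ (Finset.univ : Finset (Server P))).filter fun e =>
      ¬ o.Overloaded e.1 e.2)
    (fun e => {f | 7 * Real.exp 12 * P.c < ((Finset.univ.filter fun r : Server P × Fin P.c =>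
      o.Live r.1 ∧ pathNode (f r.1 r.2).1 (o.dest r.1 r.2) e.1 = e.2).card : ℝ)})
    (Real.exp (-P.c)) ?_
    {f | ¬ Outcome.Spread (mk fun s i => (f s i).1)} ?_
  · refine h.trans (ENNReal.ofReal_le_ofReal ?_)
    gcongr
    have : ((Finset.range (P.d + 1) ×ˢ (Finset.univ : Finset (Server P))).filter fun e =>
      ¬ o.Overloaded e.1 e.2).card ≤ (P.d + 1) * P.n := by
      refine (Finset.card_filter_le _ _).trans ?_
      rw [Finset.card_product, Finset.card_range, Finset.card_univ, card_server]
    exact_mod_cast this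
  · rintro ⟨ℓ, x⟩ he
    simp only [Finset.mem_filter, Finset.mem_product, Finset.mem_range, Finset.mem_univ,
      and_true, Nat.lt_succ_iff] at he
    obtain ⟨hℓ, hover⟩ := he
    set S : Finset (Server P × Fin P.c) := Finset.univ.filter fun e =>
      o.Live e.1 ∧ root ℓ (o.dest e.1 e.2) = root ℓ x with hS
    set Y : Finset (Intact H) := Finset.univ.filter fun v =>
      ∀ i : Fin P.d, (i : ℕ) < ℓ → v.1 i = x i with hY
    have hScard : (S.card : ℝ) ≤ Real.exp 12 * P.c * P.k ^ ℓ := by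
      unfold Overloaded at hover
      rw [not_lt] at hover
      exact hover
    have hkℓ : (0 : ℝ) < (P.k : ℝ) ^ ℓ := pow_pos k_pos _
    have hYc : (Y.card : ℝ) ≤ 2 / (P.k : ℝ) ^ ℓ * Fintype.card (Intact H) := by
      have h5 : (Y.card : ℝ) ≤ (P.k : ℝ) ^ (P.d - ℓ) := by
        have := card_subtype_filter_le (fun x => x ∉ crashedNow H)
          (fun v : Server P => ∀ i : Fin P.d, (i : ℕ) < ℓ → v i = x i)
        rw [card_agree_lt hℓ] at this
        exact_mod_cast this
      have h7 := card_intact H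
      rw [n_eq_mul hℓ] at h7
      refine h5.trans ?_
      rw [div_mul_eq_mul_div, le_div_iff₀ hkℓ]
      linarith
    have h8 := uniform_hits_le (I := Server P) (J := Fin P.c) (V := Intact H)
      S (fun _ _ => Y) (2 / (P.k : ℝ) ^ ℓ) 1 (7 * Real.exp 12 * P.c) zero_le_one (fun _ _ => hYc)
    refine le_trans (PMF.toOuterMeasure_mono _ ?_) (h8.trans (ENNReal.ofReal_le_ofReal ?_))
    · rintro f ⟨hf, -⟩
      simp only [Set.mem_ofPred_eq] at hf ⊢
      refine hf.le.trans ?_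
      norm_cast
      refine Finset.card_le_card fun r hr => ?_
      simp only [hS, hY, Finset.mem_filter, Finset.mem_univ, true_and] at hr ⊢
      obtain ⟨hl, hp⟩ := hr
      refine ⟨⟨hl, ?_⟩, fun i hi => ?_⟩
      · rw [← hp, root_pathNode]
      · rw [← hp]
        simp [pathNode, hi]
    -- The mean is at most `2 e¹² c`. With `θ = 1` the exponent is `(2e - 7) e¹² c ≤ -c`, which
    -- explains the constant `7`.
    · have h9 : 2 / (P.k : ℝ) ^ ℓ * Real.exp 1 * S.card
          ≤ 2 * Real.exp 1 * (Real.exp 12 * P.c) := by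
        calc 2 / (P.k : ℝ) ^ ℓ * Real.exp 1 * S.card
            ≤ 2 / (P.k : ℝ) ^ ℓ * Real.exp 1 * (Real.exp 12 * P.c * P.k ^ ℓ) := by gcongr
          _ = _ := by field_simp
      have h10 := Real.exp_one_lt_d9
      have h11 : (1 : ℝ) ≤ Real.exp 12 := Real.one_le_exp (by norm_num)
      have h12 : (P.c : ℝ) ≤ Real.exp 12 * P.c :=
        le_mul_of_one_le_left (Nat.cast_nonneg _) h11
      gcongr
      nlinarith
  · rintro f ⟨hf, -⟩
    simp only [Set.mem_ofPred_eq, Outcome.Spread] at hf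
    push Not at hf
    obtain ⟨ℓ, hℓ, x, hx, hlt⟩ := hf
    refine ⟨(ℓ, x), ?_, hlt⟩
    simp only [Finset.mem_filter, Finset.mem_product, Finset.mem_range, Finset.mem_univ,
      and_true, Nat.lt_succ_iff]
    exact ⟨hℓ, hx⟩

/-- The bound on the numbers of data items holds for all outcomes with the four properties, and
these fail with small probability. -/
theorem not_itemsAtLevel_le (A : Adversary P) (T : ℕ) {α β : ℝ} (hc : 0 < P.c) (hk : 36 ≤ P.k)
    (hα : 7 * Real.exp 12 ≤ α) (hβ : Real.exp 12 ≤ β)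
    (hsmall : (P.n : ℝ) * (T * P.m) * Real.exp (-P.c) ≤ 1) :
    (randomOutcome A T).toOuterMeasure
      {o | ¬ ∀ sel, o.Selection α sel → ∀ ℓ : ℕ, 1 ≤ ℓ → ℓ ≤ P.d →
        ((o.itemsAtLevel α β sel ℓ).card : ℝ) ≤ P.phi * P.n / (P.k : ℝ) ^ ℓ}
      ≤ ENNReal.ofReal (T * ((P.d + 1) * P.m * Real.exp (-P.c))
        + P.d * ((P.n : ℝ) * (T * P.m) * Real.exp (-P.c))
        + P.n * Real.exp (P.q - Real.log P.n / 2 * P.q)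
        + (P.d + 1) * P.n * Real.exp (-P.c)) := by
  have hH : (randomHistory A T).toOuterMeasure
      {H | ¬ ((∀ p ∈ H, GoodPeriod p) ∧ ∀ ℓ < P.d, Expands H ℓ)}
      ≤ ENNReal.ofReal (T * ((P.d + 1) * P.m * Real.exp (-P.c)))
        + ENNReal.ofReal (P.d * ((P.n : ℝ) * (T * P.m) * Real.exp (-P.c))) := by
    have h1 := toOuterMeasure_exists_le (randomHistory A T) (Finset.range P.d)
      (fun ℓ => {H | ¬ Expands H ℓ}) _
      (fun ℓ hℓ => not_expands_le A T (Finset.mem_range.1 hℓ).le hsmall)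
      {H | ¬ ∀ ℓ < P.d, Expands H ℓ} (by
        rintro H ⟨hH, -⟩
        simp only [Set.mem_ofPred_eq] at hH
        push Not at hH
        obtain ⟨ℓ, hℓ, hH⟩ := hH
        exact ⟨ℓ, Finset.mem_range.2 hℓ, hH⟩)
    rw [Finset.card_range] at h1
    refine le_trans (PMF.toOuterMeasure_mono _ ?_) ((MeasureTheory.measure_union_le _ _).trans
      (add_le_add (not_goodPeriods_le hk A T) h1))
    rintro H ⟨hH, -⟩
    simp only [Set.mem_ofPred_eq, not_and_or] at hH
    exact hH
  rw [ENNReal.ofReal_add (by positivity) (by positivity),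
    ENNReal.ofReal_add (by positivity) (by positivity),
    ENNReal.ofReal_add (by positivity) (by positivity), add_assoc]
  refine (toOuterMeasure_bind_le_add _ _ _
    {H | ¬ ((∀ p ∈ H, GoodPeriod p) ∧ ∀ ℓ < P.d, Expands H ℓ)} _ fun H _ hgood => ?_).trans
    (add_le_add_left hH _)
  simp only [Set.mem_ofPred_eq, not_not] at hgood
  refine toOuterMeasure_bind_le _ _ _ _ fun B _ => ?_
  have hq := all_outdated_le (by omega) H fun s => bucketOf (B.item s)
  refine (toOuterMeasure_bind_le_add _ _ _
    {f | ∃ s, ∀ j, (f s j).1 ∈ outdated H (bucketOf (B.item s))}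
    (ENNReal.ofReal ((P.d + 1) * P.n * Real.exp (-P.c))) fun ask _ hask => ?_).trans ?_
  swap
  · gcongr
  simp only [Set.mem_ofPred_eq] at hask
  push Not at hask
  rw [PMF.toOuterMeasure_map_apply]
  refine le_trans (PMF.toOuterMeasure_mono _ ?_)
    (not_spread_le H B fun s j => (ask s j).1)
  rintro st ⟨hst, -⟩ hspread
  apply hst
  intro sel hsel ℓ hℓ1 hℓ
  obtain ⟨j, rfl⟩ : ∃ j, ℓ = j + 1 := ⟨ℓ - 1, by omega⟩
  rw [phi_mul_div (by omega)]
  exact card_itemsAtLevel_le (synced_of_asked _ hask) hspread hgood.1 hgood.2 hc hk hα hβ hsel j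
    (by omega)

end RoBuSt

end

/-! ### Choice of the constants -/

theorem mainTheorem4 :
    ∃ α₀ β₀ : ℝ, 0 < α₀ ∧ 0 < β₀ ∧
      ∀ (a p τ : ℕ) (q₀ : ℝ), 0 < q₀ →
        ∃ (C₀ : ℝ) (n₀ : ℕ), 0 < C₀ ∧
          ∀ (P : RoBuSt.Params) (α β : ℝ) (A : RoBuSt.Adversary P) (T : ℕ),
            α₀ ≤ α → β₀ ≤ β →
            n₀ ≤ P.n → 36 ≤ P.k →
            P.n ≤ P.m → P.m ≤ P.n ^ p →
            C₀ * Real.log P.m ≤ P.c →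
            q₀ * Real.log P.n ≤ P.q →
            1 ≤ T → T ≤ P.n ^ τ →
            ENNReal.ofReal (1 - 1 / (P.n : ℝ) ^ a) ≤
              (RoBuSt.randomOutcome A T).toOuterMeasure
                {o | ∀ sel, o.Selection α sel → ∀ ℓ : ℕ, 1 ≤ ℓ → ℓ ≤ P.d →
                  ((o.itemsAtLevel α β sel ℓ).card : ℝ) ≤ P.phi * P.n / (P.k : ℝ) ^ ℓ} := by
  refine ⟨7 * Real.exp 12, Real.exp 12, by positivity, by positivity, ?_⟩
  intro a p τ q₀ hq₀
  -- `C₀` gives `e⁻ᶜ m ^ (a + τ + 5) ≤ 1`: a factor `m ^ (τ + 3)` pays for the union bounds and `n ^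
  -- (-(a + 2))` is left. `n₀` ensures `(log n) / 2 - 1 ≥ (a + 3) / q₀` for the asked servers, and
  -- `n ≥ 2` merges four terms into `n ^ (-a)`.
  refine ⟨a + τ + 5, max 2 ⌈Real.exp (2 + 2 * ((a + 3) / q₀))⌉₊, by positivity, ?_⟩
  intro P α β A T hα hβ hn0 hk hnm _ hc hq _ hT
  have hn2 : 2 ≤ P.n := (le_max_left _ _).trans hn0
  have hn2' : (2 : ℝ) ≤ P.n := by exact_mod_cast hn2
  have hn : (0 : ℝ) < P.n := by linarith
  have hnm' : (P.n : ℝ) ≤ P.m := by exact_mod_cast hnm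
  have hm2 : (2 : ℝ) ≤ P.m := hn2'.trans hnm'
  have hm : (0 : ℝ) < P.m := by linarith
  have hlogn : 0 < Real.log P.n := Real.log_pos (by linarith)
  have hlogm : 0 < Real.log P.m := Real.log_pos (by linarith)
  have hcpos : 0 < P.c := by
    have : (0 : ℝ) < P.c := lt_of_lt_of_le (by positivity) hc
    exact_mod_cast this
  have hec : Real.exp (-P.c) * (P.m : ℝ) ^ (a + τ + 5) ≤ 1 := by
    have : (P.m : ℝ) ^ (a + τ + 5) = Real.exp ((a + τ + 5) * Real.log P.m) := by
      rw [← Real.rpow_natCast, Real.rpow_def_of_pos hm]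
      push_cast
      ring_nf
    rw [this, ← Real.exp_add, Real.exp_le_one_iff]
    linarith
  have hT' : (T : ℝ) ≤ (P.m : ℝ) ^ τ := by
    have : (T : ℝ) ≤ (P.n : ℝ) ^ τ := by exact_mod_cast hT
    exact this.trans (by gcongr)
  have hd : (P.d : ℝ) + 1 ≤ P.m := by
    have h1 : P.d < P.k ^ P.d := Nat.lt_pow_self (by omega)
    have h2 : P.d + 1 ≤ P.n := h1
    have h3 : (P.d : ℝ) + 1 ≤ P.n := by exact_mod_cast h2
    exact h3.trans hnm'
  have hd0 : (0 : ℝ) ≤ P.d := Nat.cast_nonneg _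
  set ε := Real.exp (-(P.c : ℝ)) with hε
  have hε0 : 0 < ε := Real.exp_pos _
  have hm1 : (1 : ℝ) ≤ P.m := by linarith
  have hη : (P.m : ℝ) ^ (τ + 3) * ε ≤ 1 / (P.n : ℝ) ^ (a + 2) := by
    rw [le_div_iff₀ (by positivity)]
    calc (P.m : ℝ) ^ (τ + 3) * ε * (P.n : ℝ) ^ (a + 2)
        ≤ (P.m : ℝ) ^ (τ + 3) * ε * (P.m : ℝ) ^ (a + 2) := by gcongr
      _ = ε * (P.m : ℝ) ^ (a + τ + 5) := by ring
      _ ≤ 1 := hec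
  have hη1 : (1 : ℝ) / (P.n : ℝ) ^ (a + 2) ≤ 1 := by
    rw [div_le_one (by positivity)]
    exact one_le_pow₀ (by linarith)
  have hb1 : (T : ℝ) * ((P.d + 1) * P.m * ε) ≤ (P.m : ℝ) ^ (τ + 3) * ε := by
    calc (T : ℝ) * ((P.d + 1) * P.m * ε) ≤ (P.m : ℝ) ^ τ * (P.m * P.m * ε) := by gcongr
      _ = (P.m : ℝ) ^ (τ + 2) * ε := by ring
      _ ≤ _ := by
        gcongr ?_ * ε
        exact pow_le_pow_right₀ hm1 (by omega)
  have hb2 : (P.d : ℝ) * (P.n * (T * P.m) * ε) ≤ (P.m : ℝ) ^ (τ + 3) * ε := by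
    calc (P.d : ℝ) * (P.n * (T * P.m) * ε)
        ≤ P.m * (P.m * ((P.m : ℝ) ^ τ * P.m) * ε) := by
          gcongr
          exact_mod_cast (le_add_of_nonneg_right zero_le_one : (P.d : ℝ) ≤ P.d + 1).trans hd
      _ = _ := by ring
  have hsmall : (P.n : ℝ) * (T * P.m) * ε ≤ 1 := by
    calc (P.n : ℝ) * (T * P.m) * ε ≤ P.m * ((P.m : ℝ) ^ τ * P.m) * ε := by gcongr
      _ = (P.m : ℝ) ^ (τ + 2) * ε := by ring
      _ ≤ (P.m : ℝ) ^ (τ + 3) * ε := by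
        gcongr ?_ * ε
        exact pow_le_pow_right₀ hm1 (by omega)
      _ ≤ 1 := hη.trans hη1
  have hb4 : ((P.d : ℝ) + 1) * P.n * ε ≤ (P.m : ℝ) ^ (τ + 3) * ε := by
    calc ((P.d : ℝ) + 1) * P.n * ε ≤ P.m * P.m * ε := by gcongr
      _ = (P.m : ℝ) ^ 2 * ε := by ring
      _ ≤ _ := by
        gcongr ?_ * ε
        exact pow_le_pow_right₀ hm1 (by omega)
  have hb3 : (P.n : ℝ) * Real.exp (P.q - Real.log P.n / 2 * P.q) ≤ 1 / (P.n : ℝ) ^ (a + 2) := by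
    have h1 : 2 + 2 * ((a + 3) / q₀) ≤ Real.log P.n := by
      rw [Real.le_log_iff_exp_le hn]
      calc _ ≤ (⌈Real.exp (2 + 2 * ((a + 3) / q₀))⌉₊ : ℝ) := Nat.le_ceil _
        _ ≤ P.n := by exact_mod_cast (le_max_right _ _).trans hn0
    have h2 : (a + 3) / q₀ ≤ Real.log P.n / 2 - 1 := by linarith
    have h3 : (0 : ℝ) ≤ (a + 3) / q₀ := by positivity
    have h4 : (a + 3) * Real.log P.n ≤ P.q * (Real.log P.n / 2 - 1) := by
      calc (a + 3) * Real.log P.n = (q₀ * Real.log P.n) * ((a + 3) / q₀) := by field_simp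
        _ ≤ P.q * (Real.log P.n / 2 - 1) := by gcongr
    have h5 : (P.n : ℝ) ^ (a + 3) = Real.exp ((a + 3) * Real.log P.n) := by
      rw [← Real.rpow_natCast, Real.rpow_def_of_pos hn]
      push_cast
      ring_nf
    have h6 : Real.exp (P.q - Real.log P.n / 2 * P.q) * (P.n : ℝ) ^ (a + 3) ≤ 1 := by
      rw [h5, ← Real.exp_add, Real.exp_le_one_iff]
      linarith
    rw [le_div_iff₀ (by positivity)]
    calc _ = Real.exp (P.q - Real.log P.n / 2 * P.q) * (P.n : ℝ) ^ (a + 3) := by ring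
      _ ≤ 1 := h6
  have hfour : 4 * (1 / (P.n : ℝ) ^ (a + 2)) ≤ 1 / (P.n : ℝ) ^ a := by
    rw [mul_one_div, div_le_div_iff₀ (by positivity) (by positivity), pow_add]
    have : (4 : ℝ) ≤ (P.n : ℝ) ^ 2 := by nlinarith
    have h0 : (0 : ℝ) < (P.n : ℝ) ^ a := by positivity
    nlinarith
  have hbad := (RoBuSt.not_itemsAtLevel_le A T hcpos hk hα hβ hsmall).trans
    (ENNReal.ofReal_le_ofReal (show _ ≤ 1 / (P.n : ℝ) ^ a by linarith))
  set G := {o : RoBuSt.Outcome P | ∀ sel, o.Selection α sel → ∀ ℓ : ℕ, 1 ≤ ℓ → ℓ ≤ P.d →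
    ((o.itemsAtLevel α β sel ℓ).card : ℝ) ≤ P.phi * P.n / (P.k : ℝ) ^ ℓ}
  have hone : 1 ≤ (RoBuSt.randomOutcome A T).toOuterMeasure G +
      (RoBuSt.randomOutcome A T).toOuterMeasure Gᶜ := by
    rw [← (PMF.toOuterMeasure_apply_eq_one_iff (RoBuSt.randomOutcome A T)
      (s := Set.univ)).2 (Set.subset_univ _), ← Set.union_compl_self G]
    exact MeasureTheory.measure_union_le _ _
  rw [ENNReal.ofReal_sub _ (by positivity), ENNReal.ofReal_one, tsub_le_iff_right]
  exact hone.trans (add_le_add_right hbad _)
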